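/- Let $m\ge 1$ and let $(\triangle,\mathbf L)$ be a compact convex simple labelled polytope in $\mathbb R^m$: $\triangle=\{x: L_j(x)\ge 0,\ 1\le j\le d\}$ is compact with non-empty interior $\triangle^0$, the labels $L_j(x)=\langle n_j,x\rangle+c_j$ are affine, each $L_j$ vanishes on a facet $F_j$ of $\triangle$, these facets are pairwise distinct, and the normals of the facets meeting at any point of $\triangle$ are linearly independent (for example, a Delzant polytope, the momentum polytope of a compact toric Kähler manifold). Let $d\mu$ be Lebesgue measure and let $d\sigma$ be the measure on $\partial\triangle$ given on each facet $F_j$ by $dL_j\wedge d\sigma=-d\mu$. Let $f$ be an affine function that is positive on $\triangle$, and let $s=s_{(\triangle,\mathbf L,f)}$ be the unique affine function with $$2\int_{\partial\triangle}\varphi\,\frac{d\sigma}{f^{2m-1}}=\int_\triangle s\,\varphi\,\frac{d\mu}{f^{2m+1}}\qquad\text{for all affine }\varphi .$$ For $u$ continuous on $\triangle$ put $$\mathcal F_{(\triangle,f)}(u)=2\int_{\partial\triangle}u\,\frac{d\sigma}{f^{2m-1}}-\int_\triangle s\,u\,\frac{d\mu}{f^{2m+1}},\qquad \|u\|_b=\int_{\partial\triangle}u\,\frac{d\sigma}{f^{2m-1}}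 .$$ Let $\mathcal C_\infty$ be the set of continuous convex functions on $\triangle$ that are smooth on $\triangle^0$. Fix $x_0\in\triangle^0$ and let $\widetilde{\mathcal C}=\{u\in\mathcal C_\infty: u\ge u(x_0)=0\}$. For a convex function $u$ on $\triangle$ that is differentiable at $x_0$ let $\pi(u)(x)=u(x)-u(x_0)-du_{x_0}(x-x_0)$. Let $\mathcal S$ be the set of smooth, strictly convex functions $u$ on $\triangle^0$ (identified with their continuous extensions to $\triangle$) such that $\mathrm{Hess}(u)^{-1}$ is the restriction to $\triangle^0$ of a smooth symmetric-matrix-valued function $\mathbf H$ on $\triangle$ with: (a) $\mathbf H_\xi(n_j,\cdot)=0$ and $(d\mathbf H)_\xi(n_j,n_j)=2n_j$ for every $\xi\in F_j$; (b) for every $\xi\in\triangle$, $\mathbf H_\xi(v,v)>0$ for each vector $v$ outside the span of $\{n_j: L_j(\xi)=0\}$. Let $u_0=\frac12\sum_j L_j\log L_j$, and for $u\in\mathcal S$ let $$\mathcal E_{(\triangle,f)}(u)=\mathcal F_{(\triangle,f)}(u)-\int_\triangle\bigl(\log\det\mathrm{Hess}(u)-\log\det\mathrm{Hess}(u_0)\bigr)\frac{d\mu}{f^{2m-1}}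 .$$ Then for every $\lambda>0$ the following are equivalent: (i) $\mathcal F_{(\triangle,f)}(u)\ge\lambda\|u\|_b$ for all $u\in\widetilde{\mathcal C}$ (uniform K-stability with constant $\lambda$); (ii) for every $0\le\delta<\lambda$ there is a constant $C_\delta\in\mathbb R$ such that $\mathcal E_{(\triangle,f)}(u)\ge\delta\|\pi(u)\|_b+C_\delta$ for all $u\in\mathcal S$ (properness of the weighted relative K-energy). -/

import Mathlib

open MeasureTheory
open scoped ContDiff

namespace ToricStability

/-- A compact convex simple labelled polytope `(△, L)` in `ℝ^m`:
`△ = {x | L_j(x) ≥ 0 for all j}` with affine labels `L_j(x) = ⟨n_j, x⟩ + c_j`, `n_j = dL_j`.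
Delzant polytopes (with their primitive inward normals) are a special case. -/
structure LabelledPolytope (m : ℕ) where
  /-- the number of facets -/
  d : ℕ
  /-- the inward normals `n_j = dL_j` -/
  normal : Fin d → EuclideanSpace ℝ (Fin m)
  /-- the constant terms of the labels -/
  const : Fin d → ℝ
  /-- `△` is compact -/
  bounded : Bornology.IsBounded {x | ∀ j, 0 ≤ inner ℝ (normal j) x + const j}
  /-- `△` has nonempty interior -/
  nonempty : ∃ x, ∀ j, 0 < inner ℝ (normal j) x + const j
  /-- every label vanishes on a facet, and distinct labels on distinct facets -/
  exists_facet : ∀ j, ∃ x, inner ℝ (normal j) x + const j = 0 ∧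
    ∀ i, i ≠ j → 0 < inner ℝ (normal i) x + const i
  /-- `△` is simple: the normals of the facets meeting at a point are linearly independent -/
  simple : ∀ x, (∀ j, 0 ≤ inner ℝ (normal j) x + const j) →
    LinearIndependent ℝ
      (fun j : {j // inner ℝ (normal j) x + const j = 0} => normal j)

noncomputable section

namespace LabelledPolytope

variable {m : ℕ} (P : LabelledPolytope m)

/-- The label `L_j`. -/
def L (j : Fin P.d) (x : EuclideanSpace ℝ (Fin m)) : ℝ := inner ℝ (P.normal j) x + P.const j

/-- The closed polytope `△`. -/
def body : Set (EuclideanSpace ℝ (Fin m)) := {x | ∀ j, 0 ≤ P.L j x}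

/-- The (closed) facet `F_j`. -/
def facet (j : Fin P.d) : Set (EuclideanSpace ℝ (Fin m)) := {x | x ∈ P.body ∧ P.L j x = 0}

/-- The measure `dσ` on the facet `F_j`, determined by `dL_j ∧ dσ = ± dμ`. With the vector
`w = n_j / |n_j|²`, for which `dL_j(w) = 1`, this says that
`σ(B) = μ {b + t w | b ∈ B, 0 ≤ t ≤ 1}` for `B ⊆ F_j`; so `dσ` is the image of Lebesgue measure on
the slab `0 ≤ L_j ≤ 1` under the projection `x ↦ x - L_j(x) w` onto `{L_j = 0}`,
restricted to `F_j`. -/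
def facetMeasure (j : Fin P.d) : Measure (EuclideanSpace ℝ (Fin m)) :=
  ((volume.restrict {x | 0 ≤ P.L j x ∧ P.L j x ≤ 1}).map
    (fun x => x - P.L j x • ((‖P.normal j‖ ^ 2)⁻¹ • P.normal j))).restrict (P.facet j)

/-- The measure `dσ` on `∂△`. -/
def boundaryMeasure : Measure (EuclideanSpace ℝ (Fin m)) := ∑ j, P.facetMeasure j

/-- `s` is a weighted extremal affine function of `(△, L, f)`. -/
def IsExtremalAffine (f s : EuclideanSpace ℝ (Fin m) →ᵃ[ℝ] ℝ) : Prop :=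
  ∀ φ : EuclideanSpace ℝ (Fin m) →ᵃ[ℝ] ℝ,
    2 * ∫ x, φ x / f x ^ (2 * m - 1) ∂P.boundaryMeasure
      - ∫ x in P.body, s x * φ x / f x ^ (2 * m + 1) = 0

lemma continuous_L (j : Fin P.d) : Continuous (P.L j) := by
  unfold L; fun_prop

lemma isClosed_body : IsClosed P.body := by
  have : P.body = ⋂ j, {x | 0 ≤ P.L j x} := by ext; simp [body]
  rw [this]
  exact isClosed_iInter fun j => isClosed_le continuous_const (P.continuous_L j)

lemma isCompact_body : IsCompact P.body :=
  Metric.isCompact_of_isClosed_isBounded P.isClosed_body P.bounded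

lemma isCompact_facet (j : Fin P.d) : IsCompact (P.facet j) :=
  P.isCompact_body.inter_right (isClosed_eq (P.continuous_L j) continuous_const)

lemma facetMeasure_univ_lt_top (j : Fin P.d) : P.facetMeasure j Set.univ < ⊤ := by
  have hL := P.continuous_L j
  have hT : Continuous (fun x => x - P.L j x • ((‖P.normal j‖ ^ 2)⁻¹ • P.normal j)) := by
    fun_prop
  have hF := (P.isCompact_facet j)
  rw [facetMeasure, Measure.restrict_apply_univ, Measure.map_apply hT.measurable hF.measurableSet,
    Measure.restrict_apply (hT.measurable hF.measurableSet)]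
  have hc : IsCompact ((fun p : EuclideanSpace ℝ (Fin m) × ℝ =>
      p.1 + p.2 • ((‖P.normal j‖ ^ 2)⁻¹ • P.normal j)) '' (P.facet j ×ˢ Set.Icc (0 : ℝ) 1)) :=
    (hF.prod isCompact_Icc).image (by fun_prop)
  refine lt_of_le_of_lt (measure_mono ?_) hc.measure_lt_top
  rintro x ⟨hx, h0, h1⟩
  exact ⟨(_, P.L j x), ⟨hx, h0, h1⟩, by simp⟩

lemma integrable_boundary {g : EuclideanSpace ℝ (Fin m) → ℝ} (hg : ContinuousOn g P.body) :
    Integrable g P.boundaryMeasure := by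
  rw [boundaryMeasure, integrable_finsetSum_measure]
  intro j _
  have : IsFiniteMeasure (P.facetMeasure j) := ⟨P.facetMeasure_univ_lt_top j⟩
  have hF := P.isCompact_facet j
  have h : IntegrableOn g (P.facet j) (P.facetMeasure j) :=
    (hg.mono fun x hx => hx.1).integrableOn_compact hF
  have e : (P.facetMeasure j).restrict (P.facet j) = P.facetMeasure j := by
    rw [facetMeasure, Measure.restrict_restrict hF.measurableSet, Set.inter_self]
  rwa [IntegrableOn, e] at h

/-- The weighted extremal affine function exists and is unique. -/
theorem existsUnique_extremalAffine (f : EuclideanSpace ℝ (Fin m) →ᵃ[ℝ] ℝ)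
    (hf : ∀ x ∈ P.body, 0 < f x) : ∃! s, P.IsExtremalAffine f s := by
  have ca : ∀ g : EuclideanSpace ℝ (Fin m) →ᵃ[ℝ] ℝ, Continuous g := fun g =>
    g.continuous_of_finiteDimensional
  have hfc : ∀ n : ℕ, ∀ x ∈ P.body, f x ^ n ≠ 0 := fun n x hx => (pow_pos (hf x hx) n).ne'
  have i1 : ∀ φ : EuclideanSpace ℝ (Fin m) →ᵃ[ℝ] ℝ,
      Integrable (fun x => φ x / f x ^ (2 * m - 1)) P.boundaryMeasure := fun φ =>
    P.integrable_boundary ((ca φ).continuousOn.div ((ca f).pow _).continuousOn (hfc _))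
  have i2 : ∀ s φ : EuclideanSpace ℝ (Fin m) →ᵃ[ℝ] ℝ,
      IntegrableOn (fun x => s x * φ x / f x ^ (2 * m + 1)) P.body := fun s φ =>
    (((ca s).mul (ca φ)).continuousOn.div ((ca f).pow _).continuousOn
      (hfc _)).integrableOn_compact P.isCompact_body
  let B : (EuclideanSpace ℝ (Fin m) →ᵃ[ℝ] ℝ) →ₗ[ℝ]
      Module.Dual ℝ (EuclideanSpace ℝ (Fin m) →ᵃ[ℝ] ℝ) :=
    LinearMap.mk₂ ℝ (fun s φ => ∫ x in P.body, s x * φ x / f x ^ (2 * m + 1))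
      (fun s t φ => by
        rw [← integral_add (i2 s φ) (i2 t φ)]
        congr 1; ext x; simp; ring)
      (fun c s φ => by
        rw [smul_eq_mul, ← integral_const_mul]
        congr 1; ext x; simp; ring)
      (fun s φ ψ => by
        rw [← integral_add (i2 s φ) (i2 s ψ)]
        congr 1; ext x; simp; ring)
      (fun c s φ => by
        rw [smul_eq_mul, ← integral_const_mul]
        congr 1; ext x; simp; ring)
  have hB : ∀ s φ, B s φ = ∫ x in P.body, s x * φ x / f x ^ (2 * m + 1) := fun s φ => rfl
  let l : Module.Dual ℝ (EuclideanSpace ℝ (Fin m) →ᵃ[ℝ] ℝ) :=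
    { toFun := fun φ => 2 * ∫ x, φ x / f x ^ (2 * m - 1) ∂P.boundaryMeasure
      map_add' := fun φ ψ => by
        rw [← mul_add, ← integral_add (i1 φ) (i1 ψ)]
        refine congrArg (fun t : ℝ => 2 * t) (integral_congr_ae (.of_forall fun x => ?_))
        simp; ring
      map_smul' := fun c φ => by
        rw [RingHom.id_apply, smul_eq_mul, mul_left_comm, ← integral_const_mul c]
        refine congrArg (fun t : ℝ => 2 * t) (integral_congr_ae (.of_forall fun x => ?_))
        simp; ring }
  have hinj : Function.Injective B := by
    rw [injective_iff_map_eq_zero]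
    intro s hs
    have h0 : ∫ x in P.body, s x * s x / f x ^ (2 * m + 1) = 0 := by
      rw [← hB, hs]; rfl
    have hnn : 0 ≤ᵐ[volume.restrict P.body] fun x => s x * s x / f x ^ (2 * m + 1) := by
      filter_upwards [ae_restrict_mem P.isCompact_body.measurableSet] with x hx
      exact div_nonneg (mul_self_nonneg _) (pow_pos (hf x hx) _).le
    have hae := (setIntegral_eq_zero_iff_of_nonneg_ae hnn (i2 s s)).1 h0
    let U : Set (EuclideanSpace ℝ (Fin m)) := {x | ∀ j, 0 < P.L j x}
    have hUo : IsOpen U := by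
      have : U = ⋂ j, {x | 0 < P.L j x} := by ext; simp [U]
      rw [this]
      exact isOpen_iInter_of_finite fun j => isOpen_lt continuous_const (P.continuous_L j)
    have hUb : U ⊆ P.body := fun x hx j => (hx j).le
    obtain ⟨x0, hx0⟩ := P.nonempty
    have hUae : (fun x => s x) =ᵐ[volume.restrict U] fun _ => (0 : ℝ) := by
      filter_upwards [ae_restrict_of_ae_restrict_of_subset hUb hae,
        ae_restrict_mem hUo.measurableSet] with x hx hxU
      have := (pow_pos (hf x (hUb hxU)) (2 * m + 1)).ne'
      simpa [this] using hx
    have hU0 : Set.EqOn s (fun _ => 0) U :=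
      Measure.eqOn_open_of_ae_eq hUae hUo (ca s).continuousOn continuousOn_const
    have hspan : affineSpan ℝ U = ⊤ := hUo.affineSpan_eq_top ⟨x0, hx0⟩
    exact AffineMap.ext_on hspan fun x hx => by simpa using hU0 hx
  have hsurj : Function.Surjective B :=
    (LinearMap.injective_iff_surjective_of_finrank_eq_finrank
      Subspace.dual_finrank_eq.symm).1 hinj
  have key : ∀ s, P.IsExtremalAffine f s ↔ B s = l := by
    intro s
    rw [LinearMap.ext_iff]
    refine forall_congr' fun φ => ?_
    rw [hB, sub_eq_zero, eq_comm]
    rfl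
  obtain ⟨s, hs⟩ := hsurj l
  exact ⟨s, (key s).2 hs, fun t ht => hinj (((key t).1 ht).trans hs.symm)⟩

/-- The weighted extremal affine function `s_{(△, L, f)}`. -/
def extremalAffine (f : EuclideanSpace ℝ (Fin m) →ᵃ[ℝ] ℝ) (hf : ∀ x ∈ P.body, 0 < f x) :
    EuclideanSpace ℝ (Fin m) →ᵃ[ℝ] ℝ :=
  (P.existsUnique_extremalAffine f hf).choose

/-- The Donaldson-Futaki invariant `𝓕_{(△, f)}`, for functions continuous on `△`. -/
def futaki (f : EuclideanSpace ℝ (Fin m) →ᵃ[ℝ] ℝ) (hf : ∀ x ∈ P.body, 0 < f x)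
    (u : EuclideanSpace ℝ (Fin m) → ℝ) : ℝ :=
  2 * ∫ x, u x / f x ^ (2 * m - 1) ∂P.boundaryMeasure
    - ∫ x in P.body, P.extremalAffine f hf x * u x / f x ^ (2 * m + 1)

/-- The boundary norm `‖u‖_b`. -/
def bNorm (f : EuclideanSpace ℝ (Fin m) →ᵃ[ℝ] ℝ) (u : EuclideanSpace ℝ (Fin m) → ℝ) : ℝ :=
  ∫ x, u x / f x ^ (2 * m - 1) ∂P.boundaryMeasure

/-- The class `𝓒_∞`: continuous convex functions on `△`, smooth in the interior. (Only the values
on `△` matter.) -/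
def CInfty : Set (EuclideanSpace ℝ (Fin m) → ℝ) :=
  {u | ContinuousOn u P.body ∧ ConvexOn ℝ P.body u ∧ ContDiffOn ℝ ∞ u (interior P.body)}

/-- The normalized class `𝓒~`: functions `u ∈ 𝓒_∞` with `u ≥ u(x₀) = 0` on `△`. -/
def CTilde (x₀ : EuclideanSpace ℝ (Fin m)) : Set (EuclideanSpace ℝ (Fin m) → ℝ) :=
  {u | u ∈ P.CInfty ∧ u x₀ = 0 ∧ ∀ x ∈ P.body, 0 ≤ u x}

end LabelledPolytope

/-- The projection `π` onto functions normalized at `x₀`: it subtracts the affine function tangent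
to `u` at `x₀`. -/
def proj {m : ℕ} (x₀ : EuclideanSpace ℝ (Fin m)) (u : EuclideanSpace ℝ (Fin m) → ℝ) :
    EuclideanSpace ℝ (Fin m) → ℝ :=
  fun x => u x - (u x₀ + fderiv ℝ u x₀ (x - x₀))

/-- The Hessian matrix `(u_{,ij})`. -/
def hess {m : ℕ} (u : EuclideanSpace ℝ (Fin m) → ℝ) (x : EuclideanSpace ℝ (Fin m)) :
    Matrix (Fin m) (Fin m) ℝ :=
  Matrix.of fun i j => fderiv ℝ (fderiv ℝ u) x
    (EuclideanSpace.single i 1) (EuclideanSpace.single j 1)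

/-- The value `A(v, w) = ∑ A_{ij} v_i w_j` of the bilinear form with matrix `A`. -/
def bilin {m : ℕ} (A : Matrix (Fin m) (Fin m) ℝ) (v w : EuclideanSpace ℝ (Fin m)) : ℝ :=
  ∑ i, ∑ j, A i j * v i * w j

namespace LabelledPolytope

variable {m : ℕ} (P : LabelledPolytope m)

/-- `t_F` for the face `F` with `ξ` in its relative interior: the span of the normals of the facets
containing `ξ`. -/
def normalSpan (ξ : EuclideanSpace ℝ (Fin m)) : Submodule ℝ (EuclideanSpace ℝ (Fin m)) :=
  Submodule.span ℝ (P.normal '' {j | P.L j ξ = 0})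

/-- The conditions (smoothness, boundary values, positivity) under which a symmetric-matrix-valued
function `H` on `△` defines a torus-invariant compatible almost Kähler metric. -/
structure IsCompatible
    (H : EuclideanSpace ℝ (Fin m) → Matrix (Fin m) (Fin m) ℝ) : Prop where
  symm : ∀ ξ ∈ P.body, (H ξ).IsSymm
  smooth : ∀ i j, ContDiffOn ℝ ∞ (fun x => H x i j) P.body
  boundary : ∀ j, ∀ ξ ∈ P.facet j, ∀ v, bilin (H ξ) (P.normal j) v = 0
  /-- `(dH)_ξ(n_j, n_j) = 2 n_j` -/
  boundary_deriv : ∀ j, ∀ ξ ∈ P.facet j, ∀ v,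
    fderivWithin ℝ (fun x => bilin (H x) (P.normal j) (P.normal j)) P.body ξ v
      = 2 * inner ℝ (P.normal j) v
  /-- `H_ξ` is positive definite on `t / t_F` for `ξ` in the interior of the face `F` -/
  positive : ∀ ξ ∈ P.body, ∀ v, v ∉ P.normalSpan ξ → 0 < bilin (H ξ) v v

/-- The space `𝓢(△, L)` of symplectic potentials: smooth strictly convex functions `u` on the
interior of `△` such that `Hess(u)⁻¹` extends to `△` as a function `H` satisfying
`IsCompatible`. Such a `u` extends continuously to `△`, and is identified with its extension
(this gives the values on `∂△` that enter `𝓕_{(△, f)}` and `‖·‖_b`). -/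
def potentials : Set (EuclideanSpace ℝ (Fin m) → ℝ) :=
  {u | ContinuousOn u P.body ∧ ContDiffOn ℝ ∞ u (interior P.body) ∧
    StrictConvexOn ℝ (interior P.body) u ∧
    ∃ H, P.IsCompatible H ∧ ∀ x ∈ interior P.body, H x = (hess u x)⁻¹}

/-- The canonical symplectic potential `u₀ = ½ ∑ L_j log L_j`. -/
def canonicalPotential (x : EuclideanSpace ℝ (Fin m)) : ℝ :=
  (1 / 2) * ∑ j, P.L j x * Real.log (P.L j x)

/-- The weighted relative K-energy `𝓔_{(△, f)}`. -/
def kEnergy (f : EuclideanSpace ℝ (Fin m) →ᵃ[ℝ] ℝ) (hf : ∀ x ∈ P.body, 0 < f x)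
    (u : EuclideanSpace ℝ (Fin m) → ℝ) : ℝ :=
  P.futaki f hf u - ∫ x in P.body,
    (Real.log (hess u x).det - Real.log (hess P.canonicalPotential x).det) / f x ^ (2 * m - 1)

end LabelledPolytope

end

end ToricStability

/-! The two implications compare the linear functional $\mathcal F$ with the entropy
$\int(\log\det\mathrm{Hess}(u)-\log\det\mathrm{Hess}(u_0))\,f^{1-2m}d\mu$: it grows more slowly than
any multiple of $\|\pi(u)\|_b$, and it is nonnegative along suitable rays issuing from $u_0$.

(i) ⇒ (ii). Since $\mathcal F$ kills affine functions, stability applied to $\pi(u)$ gives $\mathcal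
F(u)\ge\lambda\|\pi(u)\|_b$. It remains to bound the entropy above by $\varepsilon\|\pi(u)\|_b+C$
with $\varepsilon=\lambda-\delta$ (`exists_entropy_le`). For a positive semidefinite matrix $A$ and
$c>0$, $\log\det A\le c\,\mathrm{tr}A+m|\log c|$. Take $c=t\psi(x)$, with $\psi$ a product of powers
of the labels that vanishes on $\partial\triangle$ (`bump`). The error $|\log\psi|$ is integrable,
and two integrations by parts turn $\int\psi\,\Delta u$ into $\int u\,\Delta\psi$, hence into a
multiple of $\int_\triangle u$. A normalized convex function increases along rays from $x_0$, so a
decomposition of $\triangle$ into cones bounds $\int_\triangle u$ by a multiple of $\|u\|_b$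
(`exists_integral_body_le_bNorm`). Choosing $t$ small makes the total factor at most $\varepsilon$.
Only an upper bound for the entropy is used, so the boundary behaviour of $\mathrm{Hess}(u)$ plays
no role here.

(ii) ⇒ (i). Let $u\in\widetilde{\mathcal C}$ and let $u_r(x)=u(x_0+r(x-x_0))$ with $r<1$; this is
smooth and convex on a neighbourhood of $\triangle$. Then $u_0+ku_r\in\mathcal S$ for every $k\ge0$
(`canonicalPotential_add_mem_potentials`). As $\det$ increases when a positive semidefinite matrix
is added, $\mathcal E(u_0+ku_r)\le\mathcal F(u_0)+k\mathcal F(u_r)$, while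
$\pi(u_0+ku_r)=\pi(u_0)+ku_r$. Properness therefore compares two affine functions of $k$; their
slopes give $\delta\|u_r\|_b\le\mathcal F(u_r)$. Finally $r\to1$ and $\delta\to\lambda$.

Membership in $\mathcal S$ requires the inverse of $R+\frac12\sum_j n_j\otimes n_j/L_j$ to extend
smoothly to $\triangle$. It is a block of the inverse of a larger matrix (`saddle`) whose entries
have no poles and which simplicity makes invertible up to the boundary. -/

namespace ToricStability

/-! ### Determinant inequalities for positive matrices -/

section MatrixInequalities

variable {n : Type*} [Fintype n] [DecidableEq n]

open Matrix

lemma log_le_mul_add_abs_log {c t : ℝ} (hc : 0 < c) (ht : 0 < t) :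
    Real.log t ≤ c * t + |Real.log c| := by
  have h := Real.log_le_sub_one_of_pos (mul_pos hc ht)
  rw [Real.log_mul hc.ne' ht.ne'] at h
  linarith [neg_abs_le (Real.log c)]

/-- Apply $\log s\le cs+|\log c|$ to each eigenvalue. The free constant `c` will depend on the
point: it lets the trace be weighted by a function vanishing on the boundary, at the cost of the
logarithm of that function. -/
lemma log_det_le_trace {A : Matrix n n ℝ} (hA : A.PosSemidef) {c : ℝ} (hc : 0 < c) :
    Real.log A.det ≤ c * A.trace + Fintype.card n * |Real.log c| := by
  have hdet : A.det = ∏ i, hA.isHermitian.eigenvalues i := by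
    simpa using hA.isHermitian.det_eq_prod_eigenvalues
  have htr : A.trace = ∑ i, hA.isHermitian.eigenvalues i := by
    simpa using hA.isHermitian.trace_eq_sum_eigenvalues
  have h0 : ∀ i, 0 ≤ hA.isHermitian.eigenvalues i := hA.eigenvalues_nonneg
  have hR : c * A.trace + Fintype.card n * |Real.log c|
      = ∑ i, (c * hA.isHermitian.eigenvalues i + |Real.log c|) := by
    rw [htr, Finset.sum_add_distrib, Finset.mul_sum]; simp
  rw [hR]
  by_cases hz : ∃ i, hA.isHermitian.eigenvalues i = 0
  · obtain ⟨i, hi⟩ := hz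
    -- A singular matrix has `Real.log 0 = 0` on the left, and every term on the right is
    -- nonnegative.
    rw [hdet, Finset.prod_eq_zero (Finset.mem_univ i) hi, Real.log_zero]
    exact Finset.sum_nonneg fun j _ => add_nonneg (mul_nonneg hc.le (h0 j)) (abs_nonneg _)
  · push Not at hz
    rw [hdet, Real.log_prod fun i _ => hz i]
    exact Finset.sum_le_sum fun i _ => log_le_mul_add_abs_log hc ((h0 i).lt_of_ne' (hz i))

/-- Each eigenvalue of $1+B$ equals $1+v\cdot Bv$ for a unit eigenvector $v$, so it is at least one.
-/
lemma one_le_det_one_add {B : Matrix n n ℝ} (hB : B.PosSemidef) : 1 ≤ (1 + B).det := by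
  have h1 : (1 + B).PosSemidef := Matrix.PosSemidef.one.add hB
  have hdet : (1 + B).det = ∏ i, h1.isHermitian.eigenvalues i := by
    simpa using h1.isHermitian.det_eq_prod_eigenvalues
  rw [hdet]
  refine Finset.one_le_prod fun i _ => ?_
  have hv := h1.isHermitian.mulVec_eigenvectorBasis i
  set v : n → ℝ := ⇑(h1.isHermitian.eigenvectorBasis i) with hvdef
  have hv1 : v ⬝ᵥ v = 1 := by
    have := h1.isHermitian.eigenvectorBasis.orthonormal.1 i
    have h2 : inner ℝ (h1.isHermitian.eigenvectorBasis i) (h1.isHermitian.eigenvectorBasis i)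
      = (1 : ℝ) := by rw [real_inner_self_eq_norm_sq, this]; norm_num
    simp only [PiLp.inner_apply, RCLike.inner_apply, conj_trivial] at h2
    exact h2
  have h3 : v ⬝ᵥ ((1 + B) *ᵥ v) = h1.isHermitian.eigenvalues i := by
    rw [hv, dotProduct_smul, hv1]; simp
  rw [add_mulVec, one_mulVec, dotProduct_add, hv1] at h3
  have := hB.dotProduct_mulVec_nonneg v
  simp only [star_trivial] at this
  linarith

-- Writing $A=C^*C$ gives $A+B=C^*(1+C^{-*}BC^{-1})C$, which reduces the claim to $A=1$.
open scoped MatrixOrder in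
lemma det_le_det_add {A B : Matrix n n ℝ} (hA : A.PosDef) (hB : B.PosSemidef) :
    A.det ≤ (A + B).det := by
  obtain ⟨C, hC⟩ := CStarAlgebra.nonneg_iff_eq_star_mul_self.mp hA.posSemidef.nonneg
  rw [star_eq_conjTranspose] at hC
  have hCu : IsUnit C.det := by
    have := hA.det_pos
    rw [hC, det_mul] at this
    exact isUnit_iff_ne_zero.2 (right_ne_zero_of_mul this.ne')
  have hCu' : IsUnit Cᴴ.det := by rw [det_conjTranspose]; exact hCu.star
  have e : A + B = Cᴴ * (1 + (C⁻¹)ᴴ * B * C⁻¹) * C := by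
    rw [mul_add, add_mul, mul_one, ← hC, conjTranspose_nonsing_inv]
    congr 1
    simp only [mul_assoc]
    rw [nonsing_inv_mul _ hCu, mul_one, ← mul_assoc, mul_nonsing_inv _ hCu', one_mul]
  have h1 := one_le_det_one_add (hB.conjTranspose_mul_mul_same C⁻¹)
  rw [e, det_mul, det_mul, mul_right_comm, ← det_mul, ← hC]
  exact le_mul_of_one_le_right hA.det_pos.le h1

end MatrixInequalities

/-! ### Convex geometry of the polytope -/

namespace LabelledPolytope

variable {m : ℕ} (P : LabelledPolytope m)

lemma L_add (j : Fin P.d) (x v : EuclideanSpace ℝ (Fin m)) :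
    P.L j (x + v) = P.L j x + inner ℝ (P.normal j) v := by
  simp only [L, inner_add_right]; ring

lemma L_dilation (j : Fin P.d) (x₀ x : EuclideanSpace ℝ (Fin m)) (r : ℝ) :
    P.L j (x₀ + r • (x - x₀)) = (1 - r) * P.L j x₀ + r * P.L j x := by
  simp only [L, inner_add_right, inner_smul_right, inner_sub_right]; ring

lemma L_combo (j : Fin P.d) (x y : EuclideanSpace ℝ (Fin m)) {a b : ℝ} (hab : a + b = 1) :
    P.L j (a • x + b • y) = a * P.L j x + b * P.L j y := by
  simp only [L, inner_add_right, inner_smul_right]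
  linear_combination (-P.const j) * hab

lemma normal_ne_zero (j : Fin P.d) : P.normal j ≠ 0 := by
  intro h
  obtain ⟨x, hx⟩ := P.nonempty
  obtain ⟨y, hy, -⟩ := P.exists_facet j
  have := hx j
  rw [h, inner_zero_left] at this hy
  linarith

lemma convex_body : Convex ℝ P.body := by
  intro x hx y hy a b ha hb hab j
  rw [P.L_combo j x y hab]
  exact add_nonneg (mul_nonneg ha (hx j)) (mul_nonneg hb (hy j))

lemma interior_body : interior P.body = {x | ∀ j, 0 < P.L j x} := by
  apply Set.Subset.antisymm
  · intro x hx j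
    by_contra hj
    have hc : Continuous fun s : ℝ => x - s • P.normal j := by fun_prop
    have h1 : ∀ᶠ s in nhds (0 : ℝ), x - s • P.normal j ∈ interior P.body :=
      hc.continuousAt.eventually_mem (by simpa using isOpen_interior.mem_nhds hx)
    obtain ⟨ε, hε, h2⟩ := Metric.eventually_nhds_iff.1 h1
    have h3 := interior_subset (h2 (y := ε / 2)
      (by rw [Real.dist_eq, sub_zero, abs_of_pos (half_pos hε)]; linarith)) j
    rw [sub_eq_add_neg, P.L_add, inner_neg_right, inner_smul_right,
      real_inner_self_eq_norm_sq] at h3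
    have h4 : 0 < ε / 2 * ‖P.normal j‖ ^ 2 :=
      mul_pos (half_pos hε) (pow_pos (norm_pos_iff.2 (P.normal_ne_zero j)) 2)
    linarith
  · refine interior_maximal (fun x hx j => (hx j).le) ?_
    have : {x | ∀ j, 0 < P.L j x} = ⋂ j, {x | 0 < P.L j x} := by ext; simp
    rw [this]
    exact isOpen_iInter_of_finite fun j => isOpen_lt continuous_const (P.continuous_L j)

lemma mem_interior_body {x : EuclideanSpace ℝ (Fin m)} :
    x ∈ interior P.body ↔ ∀ j, 0 < P.L j x := by
  rw [P.interior_body]; rfl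

lemma interior_body_nonempty : (interior P.body).Nonempty := by
  obtain ⟨x, hx⟩ := P.nonempty
  exact ⟨x, P.mem_interior_body.2 hx⟩

lemma uniqueDiffOn_body : UniqueDiffOn ℝ P.body :=
  uniqueDiffOn_convex P.convex_body P.interior_body_nonempty

/-- The recession cone of `△` is trivial. -/
lemma eq_zero_of_inner_nonneg {v : EuclideanSpace ℝ (Fin m)}
    (hv : ∀ j, 0 ≤ inner ℝ (P.normal j) v) : v = 0 := by
  obtain ⟨x, hx⟩ := P.interior_body_nonempty
  obtain ⟨B, hB⟩ := P.bounded.exists_norm_le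
  by_contra hne
  have hpos : 0 < ‖v‖ := norm_pos_iff.2 hne
  have hB0 : 0 ≤ B := (norm_nonneg x).trans (hB x (interior_subset hx))
  -- With this `s` the translation by `s • v` has length $2B+1$, more than two points of norm at
  -- most $B$ can be apart.
  set s : ℝ := (2 * B + 1) / ‖v‖ with hs
  have hs0 : 0 ≤ s := by positivity
  have hmem : x + s • v ∈ P.body := fun j => by
    rw [P.L_add, inner_smul_right]
    exact add_nonneg (interior_subset hx j) (mul_nonneg hs0 (hv j))
  have h1 := hB _ hmem
  have h2 := hB x (interior_subset hx)
  have h3 : ‖s • v‖ = 2 * B + 1 := by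
    rw [norm_smul, Real.norm_of_nonneg hs0, hs, div_mul_cancel₀ _ hpos.ne']
  have h4 : ‖s • v‖ ≤ ‖x + s • v‖ + ‖x‖ := by
    simpa using norm_sub_le (x + s • v) x
  linarith

lemma dilation_mem_body {x₀ x : EuclideanSpace ℝ (Fin m)} (hx₀ : x₀ ∈ P.body) (hx : x ∈ P.body)
    {r : ℝ} (h0 : 0 ≤ r) (h1 : r ≤ 1) : x₀ + r • (x - x₀) ∈ P.body := fun j => by
  rw [P.L_dilation]
  exact add_nonneg (mul_nonneg (by linarith) (hx₀ j)) (mul_nonneg h0 (hx j))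

lemma dilation_mem_interior {x₀ x : EuclideanSpace ℝ (Fin m)} (hx₀ : x₀ ∈ interior P.body)
    (hx : x ∈ P.body) {r : ℝ} (h0 : 0 ≤ r) (h1 : r < 1) :
    x₀ + r • (x - x₀) ∈ interior P.body := P.mem_interior_body.2 fun j => by
  rw [P.L_dilation]
  exact add_pos_of_pos_of_nonneg (mul_pos (by linarith) (P.mem_interior_body.1 hx₀ j))
    (mul_nonneg h0 (hx j))

/-! ### The inverse Hessian as a block of a saddle point inverse -/

/-- The matrix whose rows are the normals. -/
def normalMatrix : Matrix (Fin P.d) (Fin m) ℝ := Matrix.of fun j i => P.normal j i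

/-- The saddle point matrix whose Schur complement is `R + ½ ∑ n_j ⊗ n_j / L_j`. It is regular on
all of `△`, and its inverse contains the extension to `△` of the inverse of that sum. -/
noncomputable def saddle (R : Matrix (Fin m) (Fin m) ℝ) (x : EuclideanSpace ℝ (Fin m)) :
    Matrix (Fin m ⊕ Fin P.d) (Fin m ⊕ Fin P.d) ℝ :=
  Matrix.fromBlocks R P.normalMatrix.transpose P.normalMatrix
    (-Matrix.diagonal fun j => 2 * P.L j x)

open Matrix

lemma normalMatrix_mulVec (v : EuclideanSpace ℝ (Fin m)) (j : Fin P.d) :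
    (P.normalMatrix *ᵥ v.ofLp) j = inner ℝ (P.normal j) v := by
  simp [normalMatrix, mulVec, dotProduct, PiLp.inner_apply, mul_comm]

lemma eq_zero_of_normalMatrix_mulVec {a : Fin m → ℝ} (ha : P.normalMatrix *ᵥ a = 0) : a = 0 := by
  have h : WithLp.toLp 2 a = (0 : EuclideanSpace ℝ (Fin m)) :=
    P.eq_zero_of_inner_nonneg fun j => by
      rw [← P.normalMatrix_mulVec, WithLp.ofLp_toLp, ha]; simp
  simpa using congrArg WithLp.ofLp h

lemma saddle_mulVec (R : Matrix (Fin m) (Fin m) ℝ) (x : EuclideanSpace ℝ (Fin m))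
    (a : Fin m → ℝ) (b : Fin P.d → ℝ) :
    P.saddle R x *ᵥ Sum.elim a b = Sum.elim (R *ᵥ a + P.normalMatrixᵀ *ᵥ b)
      (P.normalMatrix *ᵥ a - fun j => 2 * P.L j x * b j) := by
  rw [saddle, fromBlocks_mulVec]
  congr 1
  simp only [Sum.elim_comp_inl, Sum.elim_comp_inr, neg_mulVec, ← sub_eq_add_neg]
  congr 1
  ext j; rw [mulVec_diagonal]

/-- The energy identity for the saddle point system. -/
lemma saddle_energy {R : Matrix (Fin m) (Fin m) ℝ} {x : EuclideanSpace ℝ (Fin m)}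
    {a v : Fin m → ℝ} {b : Fin P.d → ℝ}
    (h : P.saddle R x *ᵥ Sum.elim a b = Sum.elim v 0) :
    a ⬝ᵥ v = a ⬝ᵥ (R *ᵥ a) + ∑ j, 2 * P.L j x * b j ^ 2 := by
  rw [P.saddle_mulVec] at h
  have h1 : R *ᵥ a + P.normalMatrixᵀ *ᵥ b = v := by
    simpa using congrArg (fun g => g ∘ Sum.inl) h
  have h2 : (P.normalMatrix *ᵥ a - fun j => 2 * P.L j x * b j) = 0 := by
    simpa using congrArg (fun g => g ∘ Sum.inr) h
  rw [← h1, dotProduct_add, mulVec_transpose, dotProduct_comm a (b ᵥ* _), ← dotProduct_mulVec,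
    sub_eq_zero.1 h2]
  congr 1
  exact Finset.sum_congr rfl fun j _ => by ring

/-- Both terms of the energy identity are nonnegative, so $a\cdot v\le0$ forces $L_jb_j^2=0$ for all
$j$. The second block row then reads $Na=0$, and $a=0$ because the recession cone is trivial. The
case $v=0$ yields invertibility; the general case yields positivity of the extended inverse. -/
lemma saddle_kernel {R : Matrix (Fin m) (Fin m) ℝ} (hR : R.PosSemidef)
    {x : EuclideanSpace ℝ (Fin m)} (hx : x ∈ P.body) {a v : Fin m → ℝ} {b : Fin P.d → ℝ}
    (h : P.saddle R x *ᵥ Sum.elim a b = Sum.elim v 0) (hav : a ⬝ᵥ v ≤ 0) :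
    a = 0 ∧ (∀ j, P.L j x ≠ 0 → b j = 0) ∧ P.normalMatrixᵀ *ᵥ b = v := by
  have he := P.saddle_energy h
  have hRa := hR.dotProduct_mulVec_nonneg a
  simp only [star_trivial] at hRa
  have hs : ∀ j ∈ Finset.univ, 0 ≤ 2 * P.L j x * b j ^ 2 := fun j _ =>
    mul_nonneg (mul_nonneg zero_le_two (hx j)) (sq_nonneg _)
  have hs0 : ∑ j, 2 * P.L j x * b j ^ 2 = 0 :=
    le_antisymm (by linarith) (Finset.sum_nonneg hs)
  have hb : ∀ j, P.L j x ≠ 0 → b j = 0 := fun j hj => by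
    have := (Finset.sum_eq_zero_iff_of_nonneg hs).1 hs0 j (Finset.mem_univ j)
    simpa [hj] using this
  rw [P.saddle_mulVec] at h
  have h1 : R *ᵥ a + P.normalMatrixᵀ *ᵥ b = v := by
    simpa using congrArg (fun g => g ∘ Sum.inl) h
  have h2 : (P.normalMatrix *ᵥ a - fun j => 2 * P.L j x * b j) = 0 := by
    simpa using congrArg (fun g => g ∘ Sum.inr) h
  have h3 : (fun j => 2 * P.L j x * b j) = 0 := by
    ext j
    by_cases hj : P.L j x = 0
    · simp [hj]
    · simp [hb j hj]
  rw [h3, sub_zero] at h2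
  have ha := P.eq_zero_of_normalMatrix_mulVec h2
  refine ⟨ha, hb, ?_⟩
  rw [← h1, ha]; simp

lemma toLp_normalMatrix_transpose_mulVec (b : Fin P.d → ℝ) :
    WithLp.toLp 2 (P.normalMatrixᵀ *ᵥ b) = ∑ j, b j • P.normal j := by
  ext i
  simp [normalMatrix, mulVec, dotProduct, mul_comm]

lemma isUnit_det_saddle {R : Matrix (Fin m) (Fin m) ℝ} (hR : R.PosSemidef)
    {x : EuclideanSpace ℝ (Fin m)} (hx : x ∈ P.body) : IsUnit (P.saddle R x).det := by
  rw [← isUnit_iff_isUnit_det, ← mulVec_injective_iff_isUnit]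
  refine (injective_iff_map_eq_zero (P.saddle R x).mulVecLin).2 fun z hz => ?_
  obtain ⟨a, b, rfl⟩ : ∃ a b, z = Sum.elim a b := ⟨z ∘ Sum.inl, z ∘ Sum.inr, by simp⟩
  have hz' : P.saddle R x *ᵥ Sum.elim a b = Sum.elim (0 : Fin m → ℝ) (0 : Fin P.d → ℝ) := by
    rw [Sum.elim_zero_zero]; exact hz
  obtain ⟨ha, hb, hN⟩ := P.saddle_kernel hR hx hz' (by simp)
  have h1 : ∑ j, b j • P.normal j = 0 := by
    rw [← P.toLp_normalMatrix_transpose_mulVec, hN]; simp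
  have h2 : ∑ j : {j // P.L j x = 0}, b j • P.normal j = 0 := by
    -- Only the facets through `x` contribute to the relation, so simplicity applies.
    have h := Finset.sum_subtype (Finset.univ.filter fun j => P.L j x = 0)
      (F := inferInstance) (p := fun j => P.L j x = 0) (by simp) (fun j => b j • P.normal j)
    rw [← h, Finset.sum_filter_of_ne, h1]
    intro j _ hj
    by_contra hL
    exact hj (by rw [hb j hL, zero_smul])
  have h3 := Fintype.linearIndependent_iff.1 (P.simple x hx) (fun j => b j) h2
  have hb0 : b = 0 := by
    ext j
    by_cases hj : P.L j x = 0
    · exact h3 ⟨j, hj⟩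
    · exact hb j hj
  rw [ha, hb0, Sum.elim_zero_zero]

/-- The extension to `△` of the inverse of `R + ½ ∑ n_j ⊗ n_j / L_j`. -/
noncomputable def saddleInv (R : Matrix (Fin m) (Fin m) ℝ) (x : EuclideanSpace ℝ (Fin m)) :
    Matrix (Fin m) (Fin m) ℝ :=
  (P.saddle R x)⁻¹.toBlocks₁₁

lemma isSymm_saddle {R : Matrix (Fin m) (Fin m) ℝ} (hR : R.IsSymm)
    (x : EuclideanSpace ℝ (Fin m)) : (P.saddle R x).IsSymm := by
  rw [saddle]
  exact IsSymm.fromBlocks hR (by simp) (by simp [IsSymm])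

lemma isSymm_saddle_inv {R : Matrix (Fin m) (Fin m) ℝ} (hR : R.IsSymm)
    (x : EuclideanSpace ℝ (Fin m)) : (P.saddle R x)⁻¹.IsSymm := by
  rw [IsSymm, transpose_nonsing_inv, P.isSymm_saddle hR x]

lemma isSymm_saddleInv {R : Matrix (Fin m) (Fin m) ℝ} (hR : R.IsSymm)
    (x : EuclideanSpace ℝ (Fin m)) : (P.saddleInv R x).IsSymm :=
  IsSymm.ext fun i j => (P.isSymm_saddle_inv hR x).apply (Sum.inl i) (Sum.inl j)

lemma saddle_inv_mulVec (R : Matrix (Fin m) (Fin m) ℝ) (x : EuclideanSpace ℝ (Fin m))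
    (v : Fin m → ℝ) :
    ((P.saddle R x)⁻¹ *ᵥ Sum.elim v 0) ∘ Sum.inl = P.saddleInv R x *ᵥ v := by
  ext i
  simp [saddleInv, mulVec, dotProduct, toBlocks₁₁]

lemma exists_saddle_mulVec_eq {R : Matrix (Fin m) (Fin m) ℝ} (hR : R.PosSemidef)
    {x : EuclideanSpace ℝ (Fin m)} (hx : x ∈ P.body) (v : Fin m → ℝ) :
    ∃ b, P.saddle R x *ᵥ Sum.elim (P.saddleInv R x *ᵥ v) b = Sum.elim v 0 := by
  refine ⟨((P.saddle R x)⁻¹ *ᵥ Sum.elim v 0) ∘ Sum.inr, ?_⟩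
  rw [← P.saddle_inv_mulVec, Sum.elim_comp_inl_inr, mulVec_mulVec,
    mul_nonsing_inv _ (P.isUnit_det_saddle hR hx), one_mulVec]

lemma bilin_eq_dotProduct (A : Matrix (Fin m) (Fin m) ℝ) (v w : EuclideanSpace ℝ (Fin m)) :
    bilin A v w = v.ofLp ⬝ᵥ (A *ᵥ w.ofLp) := by
  simp only [bilin, dotProduct, mulVec, Finset.mul_sum]
  exact Finset.sum_congr rfl fun i _ => Finset.sum_congr rfl fun j _ => by ring

/-- This column is the source of both boundary conditions. Inverting it gives
$M^{-1}n_j=e_j+2L_jM^{-1}e_j$, so pairing with $n_j$ produces a factor $2L_j$, and pairing twice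
gives $2L_j(1+O(L_j))$. -/
lemma saddle_mulVec_single (R : Matrix (Fin m) (Fin m) ℝ) (x : EuclideanSpace ℝ (Fin m))
    (j : Fin P.d) :
    P.saddle R x *ᵥ Pi.single (Sum.inr j) 1 = Sum.elim (P.normal j).ofLp 0
      - (2 * P.L j x) • (Pi.single (Sum.inr j) 1 : Fin m ⊕ Fin P.d → ℝ) := by
  ext i
  rw [mulVec_single_one]
  rcases i with i | i
  · simp [saddle, normalMatrix]
  · by_cases h : i = j
    · subst h; simp [saddle]
    · simp [saddle, h]

lemma saddle_inv_mulVec_normal {R : Matrix (Fin m) (Fin m) ℝ} (hR : R.PosSemidef)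
    {x : EuclideanSpace ℝ (Fin m)} (hx : x ∈ P.body) (j : Fin P.d) :
    (P.saddle R x)⁻¹ *ᵥ Sum.elim (P.normal j).ofLp 0 = Pi.single (Sum.inr j) 1
      + (2 * P.L j x) • ((P.saddle R x)⁻¹ *ᵥ Pi.single (Sum.inr j) 1) := by
  have h := congrArg (fun z => (P.saddle R x)⁻¹ *ᵥ z) (P.saddle_mulVec_single R x j)
  simp only [mulVec_mulVec, nonsing_inv_mul _ (P.isUnit_det_saddle hR hx), one_mulVec,
    mulVec_sub, mulVec_smul] at h
  exact eq_add_of_sub_eq h.symm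

lemma bilin_saddleInv_normal {R : Matrix (Fin m) (Fin m) ℝ} (hR : R.PosSemidef)
    {x : EuclideanSpace ℝ (Fin m)} (hx : x ∈ P.body) (j : Fin P.d)
    (v : EuclideanSpace ℝ (Fin m)) :
    bilin (P.saddleInv R x) (P.normal j) v
      = 2 * P.L j x * ((P.saddle R x)⁻¹ *ᵥ Sum.elim v.ofLp 0) (Sum.inr j) := by
  have hs := P.isSymm_saddle_inv (by simpa [IsSymm, IsHermitian] using hR.isHermitian) x
  rw [bilin_eq_dotProduct, dotProduct_comm, dotProduct_comm, ← P.saddle_inv_mulVec]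
  have h1 : (P.normal j).ofLp ⬝ᵥ (((P.saddle R x)⁻¹ *ᵥ Sum.elim v.ofLp 0) ∘ Sum.inl)
      = Sum.elim (P.normal j).ofLp 0 ⬝ᵥ ((P.saddle R x)⁻¹ *ᵥ Sum.elim v.ofLp 0) := by
    simp [dotProduct]
  have h2 : ∀ y : Fin m ⊕ Fin P.d → ℝ, y ⬝ᵥ ((P.saddle R x)⁻¹ *ᵥ Sum.elim v.ofLp 0)
      = ((P.saddle R x)⁻¹ *ᵥ y) ⬝ᵥ Sum.elim v.ofLp 0 := fun y => by
    rw [dotProduct_mulVec, ← mulVec_transpose, hs]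
  rw [h1, h2, P.saddle_inv_mulVec_normal hR hx, add_dotProduct, smul_dotProduct, ← h2]
  simp

lemma bilin_saddleInv_normal_normal {R : Matrix (Fin m) (Fin m) ℝ} (hR : R.PosSemidef)
    {x : EuclideanSpace ℝ (Fin m)} (hx : x ∈ P.body) (j : Fin P.d) :
    bilin (P.saddleInv R x) (P.normal j) (P.normal j)
      = 2 * P.L j x * (1 + 2 * P.L j x * (P.saddle R x)⁻¹ (Sum.inr j) (Sum.inr j)) := by
  rw [P.bilin_saddleInv_normal hR hx, P.saddle_inv_mulVec_normal hR hx]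
  simp

/-- If the value were nonpositive, `saddle_kernel` with $a=Hv$ would give $v=\sum_jb_jn_j$ with $b$
supported on the facets through `x`. -/
lemma bilin_saddleInv_pos {R : Matrix (Fin m) (Fin m) ℝ} (hR : R.PosSemidef)
    {x : EuclideanSpace ℝ (Fin m)} (hx : x ∈ P.body) {v : EuclideanSpace ℝ (Fin m)}
    (hv : v ∉ P.normalSpan x) : 0 < bilin (P.saddleInv R x) v v := by
  by_contra hneg
  obtain ⟨b, hb⟩ := P.exists_saddle_mulVec_eq hR hx v.ofLp
  rw [bilin_eq_dotProduct, dotProduct_comm, not_lt] at hneg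
  obtain ⟨-, hb0, hN⟩ := P.saddle_kernel hR hx hb hneg
  apply hv
  have : v = ∑ j, b j • P.normal j := by
    rw [← P.toLp_normalMatrix_transpose_mulVec, hN, WithLp.toLp_ofLp]
  rw [this]
  refine Submodule.sum_mem _ fun j _ => ?_
  by_cases hj : P.L j x = 0
  · exact Submodule.smul_mem _ _ (Submodule.subset_span ⟨j, hj, rfl⟩)
  · rw [hb0 j hj, zero_smul]; exact Submodule.zero_mem _

/-- The Hessian `½ ∑ n_j ⊗ n_j / L_j` of the canonical potential. -/
noncomputable def canonicalHess (x : EuclideanSpace ℝ (Fin m)) : Matrix (Fin m) (Fin m) ℝ :=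
  P.normalMatrixᵀ * (diagonal fun j => (2 * P.L j x)⁻¹) * P.normalMatrix

/-- In the interior the labels are invertible. Eliminating $b=(2L)^{-1}Na$ from the saddle point
system leaves the Schur complement $R+N^{T}(2L)^{-1}N$ acting on $a$. -/
lemma saddleInv_eq_inv {R : Matrix (Fin m) (Fin m) ℝ} (hR : R.PosSemidef)
    {x : EuclideanSpace ℝ (Fin m)} (hx : x ∈ interior P.body) :
    P.saddleInv R x = (P.canonicalHess x + R)⁻¹ := by
  symm
  apply inv_eq_right_inv
  refine ext_of_mulVec_single fun i => ?_
  obtain ⟨b, hb⟩ := P.exists_saddle_mulVec_eq hR (interior_subset hx) (Pi.single i 1)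
  rw [P.saddle_mulVec] at hb
  have h1 := congrArg (fun g => g ∘ Sum.inl) hb
  have h2 := congrArg (fun g => g ∘ Sum.inr) hb
  simp only [Sum.elim_comp_inl, Sum.elim_comp_inr] at h1 h2
  have h3 : b = (diagonal fun j => (2 * P.L j x)⁻¹) *ᵥ
      (P.normalMatrix *ᵥ (P.saddleInv R x *ᵥ Pi.single i 1)) := by
    rw [sub_eq_zero.1 h2]
    ext j
    have := (P.mem_interior_body.1 hx j).ne'
    rw [mulVec_diagonal]
    field_simp
  rw [one_mulVec, ← mulVec_mulVec, add_mulVec, canonicalHess, ← mulVec_mulVec, ← mulVec_mulVec,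
    ← h3, add_comm, h1]

lemma posDef_canonicalHess {x : EuclideanSpace ℝ (Fin m)} (hx : x ∈ interior P.body) :
    (P.canonicalHess x).PosDef := by
  have h := (PosDef.diagonal (R := ℝ) (d := fun j => (2 * P.L j x)⁻¹)
    fun j => inv_pos.2 (mul_pos two_pos (P.mem_interior_body.1 hx j))).conjTranspose_mul_mul_same
    (B := P.normalMatrix) (by
      refine (injective_iff_map_eq_zero P.normalMatrix.mulVecLin).2 fun a ha => ?_
      exact P.eq_zero_of_normalMatrix_mulVec ha)
  simpa [canonicalHess] using h

end LabelledPolytope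

/-! ### Smoothness of matrix inverses -/

section Smoothness

variable {E ι : Type*} [NormedAddCommGroup E] [NormedSpace ℝ E] [Fintype ι] [DecidableEq ι]
  {n : WithTop ℕ∞} {s : Set E} {A : E → Matrix ι ι ℝ}

lemma contDiffOn_matrix_det (hA : ∀ i j, ContDiffOn ℝ n (fun x => A x i j) s) :
    ContDiffOn ℝ n (fun x => (A x).det) s := by
  simp only [Matrix.det_apply]
  refine ContDiffOn.sum fun σ _ => ?_
  exact (contDiffOn_prod fun i _ => hA _ _).const_smul _

/-- Cramer's rule: entries of the inverse are quotients of determinants. -/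
lemma contDiffOn_matrix_inv (hA : ∀ i j, ContDiffOn ℝ n (fun x => A x i j) s)
    (hu : ∀ x ∈ s, IsUnit (A x).det) (i j : ι) :
    ContDiffOn ℝ n (fun x => (A x)⁻¹ i j) s := by
  have h : ∀ x, (A x)⁻¹ i j = ((A x).det)⁻¹ * ((A x).updateRow j (Pi.single i 1)).det := by
    intro x
    rw [Matrix.inv_def, Matrix.smul_apply, Matrix.adjugate_apply, Ring.inverse_eq_inv',
      smul_eq_mul]
  simp only [h]
  refine ((contDiffOn_matrix_det hA).inv fun x hx => (hu x hx).ne_zero).mul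
    (contDiffOn_matrix_det fun k l => ?_)
  by_cases hk : k = j
  · subst hk; simp only [Matrix.updateRow_self]; exact contDiffOn_const
  · simp only [Matrix.updateRow_ne hk]; exact hA k l

end Smoothness

/-! ### Smoothness and boundary conditions for the extended inverse -/

namespace LabelledPolytope

variable {m : ℕ} (P : LabelledPolytope m)

lemma contDiff_L (j : Fin P.d) : ContDiff ℝ ∞ (P.L j) := by
  unfold L
  exact (innerSL ℝ (P.normal j)).contDiff.add contDiff_const

lemma contDiffOn_saddle_inv {R : EuclideanSpace ℝ (Fin m) → Matrix (Fin m) (Fin m) ℝ}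
    (hR : ∀ x ∈ P.body, (R x).PosSemidef)
    (hs : ∀ i j, ContDiffOn ℝ ∞ (fun x => R x i j) P.body) (k l : Fin m ⊕ Fin P.d) :
    ContDiffOn ℝ ∞ (fun x => (P.saddle (R x) x)⁻¹ k l) P.body := by
  refine contDiffOn_matrix_inv (fun i j => ?_) (fun x hx => P.isUnit_det_saddle (hR x hx) hx) k l
  rcases i with i | i <;> rcases j with j | j
  · exact hs i j
  · exact contDiffOn_const
  · exact contDiffOn_const
  · by_cases h : i = j
    · subst h
      simp only [saddle, Matrix.fromBlocks_apply₂₂, Matrix.neg_apply, Matrix.diagonal_apply_eq]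
      exact (contDiff_const.mul (P.contDiff_L i)).neg.contDiffOn
    · simp only [saddle, Matrix.fromBlocks_apply₂₂, Matrix.neg_apply,
        Matrix.diagonal_apply_ne _ h]
      exact contDiffOn_const

lemma isCompatible_saddleInv {R : EuclideanSpace ℝ (Fin m) → Matrix (Fin m) (Fin m) ℝ}
    (hR : ∀ x ∈ P.body, (R x).PosSemidef)
    (hs : ∀ i j, ContDiffOn ℝ ∞ (fun x => R x i j) P.body) :
    P.IsCompatible fun x => P.saddleInv (R x) x where
  symm x hx := P.isSymm_saddleInv
    (by simpa [Matrix.IsSymm, Matrix.IsHermitian] using (hR x hx).isHermitian) x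
  smooth i j := P.contDiffOn_saddle_inv hR hs (Sum.inl i) (Sum.inl j)
  boundary j ξ hξ v := by
    rw [P.bilin_saddleInv_normal (hR ξ hξ.1) hξ.1, hξ.2]; simp
  boundary_deriv j ξ hξ v := by
    have hu := P.uniqueDiffOn_body ξ hξ.1
    have hcongr : ∀ x ∈ P.body, bilin (P.saddleInv (R x) x) (P.normal j) (P.normal j)
        = 2 * P.L j x * (1 + 2 * P.L j x *
          (P.saddle (R x) x)⁻¹ (Sum.inr j) (Sum.inr j)) := fun x hx =>
      P.bilin_saddleInv_normal_normal (hR x hx) hx j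
    have hL : HasFDerivAt (P.L j) (innerSL ℝ (P.normal j)) ξ :=
      (innerSL ℝ (P.normal j)).hasFDerivAt.add_const _
    have hq : DifferentiableWithinAt ℝ
        (fun x => (P.saddle (R x) x)⁻¹ (Sum.inr j) (Sum.inr j)) P.body ξ :=
      (P.contDiffOn_saddle_inv hR hs (Sum.inr j) (Sum.inr j)).differentiableOn
        (by simp) ξ hξ.1
    have h2L := hL.hasFDerivWithinAt (s := P.body).const_mul 2
    -- The function is $2L_j(1+2L_jq)$. At a point with $L_j=0$ the product rule leaves only
    -- $2\,dL_j$.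
    have hd := h2L.mul ((h2L.mul hq.hasFDerivWithinAt).const_add 1)
    rw [fderivWithin_congr hcongr (hcongr ξ hξ.1)]
    refine (DFunLike.congr_fun (hd.fderivWithin hu) v).trans ?_
    simp [hξ.2]
  positive ξ hξ v hv := P.bilin_saddleInv_pos (hR ξ hξ) hξ hv

end LabelledPolytope

lemma two_le_infty : (2 : WithTop ℕ∞) ≤ ∞ := WithTop.coe_le_coe.2 le_top

/-! ### First and second order properties of convex functions -/

section ConvexCalculus

variable {E : Type*} [NormedAddCommGroup E] [NormedSpace ℝ E] {s : Set E} {u : E → ℝ}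

lemma _root_.ConvexOn.add_fderiv_le (hu : ConvexOn ℝ s u) {x y : E} (hx : x ∈ s) (hy : y ∈ s)
    (hd : DifferentiableAt ℝ u x) : u x + fderiv ℝ u x (y - x) ≤ u y := by
  have hc : ConvexOn ℝ (AffineMap.lineMap x y ⁻¹' s) (u ∘ AffineMap.lineMap (k := ℝ) x y) :=
    hu.comp_affineMap _
  have hline : HasDerivAt (fun t : ℝ => AffineMap.lineMap x y t) (y - x) 0 :=
    AffineMap.hasDerivAt_lineMap
  have hd' : HasFDerivAt u (fderiv ℝ u x) (AffineMap.lineMap x y (0 : ℝ)) := by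
    simpa using hd.hasFDerivAt
  have h := hc.le_slope_of_hasDerivAt (x := 0) (y := 1) (by simpa using hx) (by simpa using hy)
    zero_lt_one (hd'.comp_hasDerivAt (0 : ℝ) hline)
  simp [slope] at h
  simp only [map_sub]
  linarith

/-- Adding the tangent inequalities at $x$ and at $x+tv$ shows that the derivative along $v$ is
monotone; its difference quotients, and hence their limit, are nonnegative. -/
lemma _root_.ConvexOn.fderiv_fderiv_nonneg (hu : ConvexOn ℝ s u) (hs : IsOpen s) {x : E}
    (hx : x ∈ s) (hd : ContDiffOn ℝ 2 u s) (v : E) : 0 ≤ fderiv ℝ (fderiv ℝ u) x v v := by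
  have hdiff : ∀ y ∈ s, DifferentiableAt ℝ u y := fun y hy =>
    (hd.contDiffAt (hs.mem_nhds hy)).differentiableAt (by simp)
  have hd2 : DifferentiableAt ℝ (fderiv ℝ u) x :=
    ((hd.contDiffAt (hs.mem_nhds hx)).fderiv_right (m := 1) (by norm_num)).differentiableAt
      (by simp)
  have hline : HasDerivAt (fun t : ℝ => x + t • v) v 0 := by
    simpa using ((hasDerivAt_id (0 : ℝ)).smul_const v).const_add x
  have hφ : HasDerivAt (fun t : ℝ => fderiv ℝ u (x + t • v) v)
      (fderiv ℝ (fderiv ℝ u) x v v) 0 := by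
    have h1 : HasFDerivAt (fderiv ℝ u) (fderiv ℝ (fderiv ℝ u) x) (x + (0 : ℝ) • v) := by
      simpa using hd2.hasFDerivAt
    exact (ContinuousLinearMap.apply ℝ ℝ v).hasFDerivAt.comp_hasDerivAt (0 : ℝ)
      (h1.comp_hasDerivAt (0 : ℝ) hline)
  have hmem : ∀ᶠ t in nhds (0 : ℝ), x + t • v ∈ s :=
    hline.continuousAt.eventually_mem (by simpa using hs.mem_nhds hx)
  have hlim := (hasDerivAt_iff_tendsto_slope.1 hφ).mono_left
    (nhdsWithin_mono (0 : ℝ) (fun t (ht : t ∈ Set.Ioi (0 : ℝ)) => ne_of_gt ht))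
  refine ge_of_tendsto hlim ?_
  filter_upwards [nhdsWithin_le_nhds hmem, self_mem_nhdsWithin] with t ht (htpos : 0 < t)
  have h1 := hu.add_fderiv_le hx ht (hdiff x hx)
  have h2 := hu.add_fderiv_le ht hx (hdiff _ ht)
  have e1 : x + t • v - x = t • v := by abel
  have e2 : x - (x + t • v) = -(t • v) := by abel
  rw [e1, map_smul, smul_eq_mul] at h1
  rw [e2, map_neg, map_smul, smul_eq_mul] at h2
  simp only [slope, sub_zero, zero_smul, add_zero, vsub_eq_sub, smul_eq_mul]
  refine mul_nonneg (inv_nonneg.2 htpos.le) ?_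
  by_contra hneg
  have := mul_neg_of_pos_of_neg htpos (not_le.1 hneg)
  linarith

end ConvexCalculus

/-! ### Calculus of the Hessian matrix -/

section Hessian

variable {m : ℕ} {u v : EuclideanSpace ℝ (Fin m) → ℝ} {x : EuclideanSpace ℝ (Fin m)}
  {s : Set (EuclideanSpace ℝ (Fin m))}

lemma eventually_differentiableAt (hu : ContDiffAt ℝ 2 u x) :
    ∀ᶠ y in nhds x, DifferentiableAt ℝ u y := by
  filter_upwards [hu.eventually (by simp)] with y hy
  exact hy.differentiableAt (by simp)

lemma differentiableAt_fderiv (hu : ContDiffAt ℝ 2 u x) :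
    DifferentiableAt ℝ (fderiv ℝ u) x :=
  (hu.fderiv_right (m := 1) (by norm_num)).differentiableAt (by simp)

lemma hess_add_smul (hu : ContDiffAt ℝ 2 u x) (hv : ContDiffAt ℝ 2 v x) (c : ℝ) :
    hess (fun y => u y + c * v y) x = hess u x + c • hess v x := by
  have h : fderiv ℝ (fun y => u y + c * v y) =ᶠ[nhds x]
      fun y => fderiv ℝ u y + c • fderiv ℝ v y := by
    filter_upwards [eventually_differentiableAt hu, eventually_differentiableAt hv] with y h1 h2
    exact (h1.hasFDerivAt.add (h2.hasFDerivAt.const_mul c)).fderiv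
  have h' := ((differentiableAt_fderiv hu).hasFDerivAt.add
    ((differentiableAt_fderiv hv).hasFDerivAt.const_smul c)).fderiv
  ext i j
  simp only [hess, Matrix.of_apply, Matrix.add_apply, Matrix.smul_apply]
  rw [h.fderiv_eq]
  exact congrArg (fun T => T (EuclideanSpace.single i 1) (EuclideanSpace.single j 1)) h'

lemma hess_const_mul (hv : ContDiffAt ℝ 2 v x) (c : ℝ) :
    hess (fun y => c * v y) x = c • hess v x := by
  have h := hess_add_smul (u := fun _ => (0 : ℝ)) (x := x) contDiffAt_const hv c
  have h0 : hess (fun _ : EuclideanSpace ℝ (Fin m) => (0 : ℝ)) x = 0 := by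
    ext i j; simp [hess]
  simpa [h0] using h

lemma hess_proj (hu : ContDiffAt ℝ 2 u x) (x₀ : EuclideanSpace ℝ (Fin m)) :
    hess (proj x₀ u) x = hess u x := by
  have h : fderiv ℝ (proj x₀ u) =ᶠ[nhds x] fun y => fderiv ℝ u y - fderiv ℝ u x₀ := by
    filter_upwards [eventually_differentiableAt hu] with y h1
    have h2 : HasFDerivAt (fun z => u x₀ + fderiv ℝ u x₀ (z - x₀)) (fderiv ℝ u x₀) y :=
      ((fderiv ℝ u x₀).hasFDerivAt.comp y ((hasFDerivAt_id y).sub_const x₀)).const_add _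
    exact (h1.hasFDerivAt.sub h2).fderiv
  ext i j
  simp only [hess, Matrix.of_apply]
  rw [h.fderiv_eq, fderiv_sub_const]

lemma hess_comp_dilation (x₀ : EuclideanSpace ℝ (Fin m)) (r : ℝ)
    (hu : ContDiffAt ℝ 2 u (x₀ + r • (x - x₀))) :
    hess (fun y => u (x₀ + r • (y - x₀))) x = r ^ 2 • hess u (x₀ + r • (x - x₀)) := by
  have hδ : ∀ y, HasFDerivAt (fun y : EuclideanSpace ℝ (Fin m) => x₀ + r • (y - x₀))
      (r • ContinuousLinearMap.id ℝ (EuclideanSpace ℝ (Fin m))) y := fun y =>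
    (((hasFDerivAt_id y).sub_const x₀).const_smul r).const_add x₀
  have hcont : ContinuousAt (fun y : EuclideanSpace ℝ (Fin m) => x₀ + r • (y - x₀)) x :=
    (hδ x).continuousAt
  have h : fderiv ℝ (fun y => u (x₀ + r • (y - x₀))) =ᶠ[nhds x]
      fun y => r • fderiv ℝ u (x₀ + r • (y - x₀)) := by
    filter_upwards [hcont.eventually (eventually_differentiableAt hu)] with y hy
    refine (hy.hasFDerivAt.comp y (hδ y)).fderiv.trans ?_
    ext w; simp
  have h' := (((differentiableAt_fderiv hu).hasFDerivAt.comp x (hδ x)).const_smul r).fderiv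
  ext i j
  simp only [hess, Matrix.of_apply, Matrix.smul_apply]
  rw [h.fderiv_eq]
  refine (congrArg (fun T => T (EuclideanSpace.single i 1) (EuclideanSpace.single j 1)) h').trans ?_
  simp; ring

lemma dotProduct_hess_mulVec (w : Fin m → ℝ) :
    w ⬝ᵥ (hess u x).mulVec w
      = fderiv ℝ (fderiv ℝ u) x (WithLp.toLp 2 w) (WithLp.toLp 2 w) := by
  have hw : WithLp.toLp 2 w = ∑ i, w i • EuclideanSpace.single i (1 : ℝ) := by
    ext k; simp [Pi.single_apply]
  rw [hw]
  simp [dotProduct, Matrix.mulVec, hess, Finset.mul_sum]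
  rw [Finset.sum_comm]
  exact Finset.sum_congr rfl fun i _ => Finset.sum_congr rfl fun j _ => by ring

lemma posSemidef_hess (hs : IsOpen s) (hu : ConvexOn ℝ s u) (hd : ContDiffOn ℝ ∞ u s)
    (hx : x ∈ s) : (hess u x).PosSemidef := by
  have hd2 : ContDiffOn ℝ 2 u s := hd.of_le two_le_infty
  refine Matrix.PosSemidef.of_dotProduct_mulVec_nonneg ?_ fun w => ?_
  · ext i j
    have := (hd2.contDiffAt (hs.mem_nhds hx)).isSymmSndFDerivAt (by simp)
    simpa [hess] using this.eq _ _
  · rw [star_trivial, dotProduct_hess_mulVec]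
    exact hu.fderiv_fderiv_nonneg hs hx hd2 _

lemma contDiffOn_hess (hs : IsOpen s) (hd : ContDiffOn ℝ ∞ u s) (i j : Fin m) :
    ContDiffOn ℝ ∞ (fun x => hess u x i j) s := by
  have h1 := hd.fderiv_of_isOpen hs (m := ∞) (by simp)
  have h2 := h1.fderiv_of_isOpen hs (m := ∞) (by simp)
  exact (h2.clm_apply contDiffOn_const).clm_apply contDiffOn_const

end Hessian

/-! ### The canonical potential and its smooth convex perturbations -/

namespace LabelledPolytope

variable {m : ℕ} (P : LabelledPolytope m)

lemma hasFDerivAt_L (j : Fin P.d) (x : EuclideanSpace ℝ (Fin m)) :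
    HasFDerivAt (P.L j) (innerSL ℝ (P.normal j)) x :=
  (innerSL ℝ (P.normal j)).hasFDerivAt.add_const _

lemma continuous_canonicalPotential : Continuous P.canonicalPotential := by
  unfold canonicalPotential
  refine continuous_const.mul (continuous_finsetSum _ fun j _ => ?_)
  exact Real.continuous_mul_log.comp (P.continuous_L j)

lemma contDiffOn_canonicalPotential :
    ContDiffOn ℝ ∞ P.canonicalPotential (interior P.body) := by
  unfold canonicalPotential
  refine contDiffOn_const.mul (ContDiffOn.sum fun j _ => ?_)
  exact (P.contDiff_L j).contDiffOn.mul ((P.contDiff_L j).contDiffOn.log fun x hx =>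
    (P.mem_interior_body.1 hx j).ne')

lemma hess_canonicalPotential {x : EuclideanSpace ℝ (Fin m)} (hx : x ∈ interior P.body) :
    hess P.canonicalPotential x = P.canonicalHess x := by
  have h : fderiv ℝ P.canonicalPotential =ᶠ[nhds x]
      fun y => (1 / 2 : ℝ) • ∑ j, (Real.log (P.L j y) + 1) • innerSL ℝ (P.normal j) := by
    filter_upwards [isOpen_interior.mem_nhds hx] with y hy
    have hj : ∀ j ∈ Finset.univ, HasFDerivAt (fun z => P.L j z * Real.log (P.L j z))
        ((Real.log (P.L j y) + 1) • innerSL ℝ (P.normal j)) y := fun j _ =>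
      (Real.hasDerivAt_mul_log (P.mem_interior_body.1 hy j).ne').comp_hasFDerivAt y
        (P.hasFDerivAt_L j y)
    exact ((HasFDerivAt.fun_sum hj).const_mul (1 / 2)).fderiv
  have h' : HasFDerivAt
      (fun y => (1 / 2 : ℝ) • ∑ j, (Real.log (P.L j y) + 1) • innerSL ℝ (P.normal j))
      ((1 / 2 : ℝ) • ∑ j, ((P.L j x)⁻¹ • innerSL ℝ (P.normal j)).smulRight
        (innerSL ℝ (P.normal j))) x := by
    have hj : ∀ j ∈ Finset.univ, HasFDerivAt
        (fun y => (Real.log (P.L j y) + 1) • innerSL ℝ (P.normal j))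
        (((P.L j x)⁻¹ • innerSL ℝ (P.normal j)).smulRight (innerSL ℝ (P.normal j))) x := fun j _ =>
      (((P.hasFDerivAt_L j x).log (P.mem_interior_body.1 hx j).ne').add_const 1).smul_const
        (innerSL ℝ (P.normal j))
    exact (HasFDerivAt.fun_sum hj).const_smul (1 / 2 : ℝ)
  ext i k
  simp only [hess, Matrix.of_apply]
  rw [h.fderiv_eq, h'.fderiv]
  rw [canonicalHess, Matrix.mul_apply]
  simp only [Matrix.mul_diagonal, normalMatrix,
    Matrix.transpose_apply, Matrix.of_apply, smul_apply,
    sum_apply, ContinuousLinearMap.smulRight_apply, innerSL_apply_apply,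
    smul_eq_mul, EuclideanSpace.inner_single_right, Finset.mul_sum]
  refine Finset.sum_congr rfl fun j _ => ?_
  simp; ring

lemma strictConvexOn_canonicalPotential :
    StrictConvexOn ℝ (interior P.body) P.canonicalPotential := by
  refine ⟨P.convex_body.interior, fun x hx y hy hxy a b ha hb hab => ?_⟩
  have hle : ∀ j, P.L j (a • x + b • y) * Real.log (P.L j (a • x + b • y))
      ≤ a * (P.L j x * Real.log (P.L j x)) + b * (P.L j y * Real.log (P.L j y)) := fun j => by
    rw [P.L_combo j x y hab]
    exact Real.convexOn_mul_log.2 (P.mem_interior_body.1 hx j).le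
      (P.mem_interior_body.1 hy j).le ha.le hb.le hab
  -- The labels separate points, since the recession cone is trivial; strict convexity of $s\log s$
  -- is needed for one label only.
  obtain ⟨j, hj⟩ : ∃ j, P.L j x ≠ P.L j y := by
    by_contra hne
    push Not at hne
    refine hxy (sub_eq_zero.1 (P.eq_zero_of_inner_nonneg fun j => ?_))
    have := hne j
    simp only [L, add_left_inj] at this
    rw [inner_sub_right, this, sub_self]
  have hlt : P.L j (a • x + b • y) * Real.log (P.L j (a • x + b • y))
      < a * (P.L j x * Real.log (P.L j x)) + b * (P.L j y * Real.log (P.L j y)) := by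
    rw [P.L_combo j x y hab]
    exact Real.strictConvexOn_mul_log.2 (P.mem_interior_body.1 hx j).le
      (P.mem_interior_body.1 hy j).le hj ha hb hab
  have hsum := Finset.sum_lt_sum (fun j (_ : j ∈ Finset.univ) => hle j) ⟨j, Finset.mem_univ j, hlt⟩
  rw [Finset.sum_add_distrib, ← Finset.mul_sum, ← Finset.mul_sum] at hsum
  simp only [canonicalPotential, smul_eq_mul]
  linarith

/-- Adding to the canonical potential a convex function that is smooth up to the boundary gives a
symplectic potential. -/
lemma canonicalPotential_add_mem_potentials {s : Set (EuclideanSpace ℝ (Fin m))} (hs : IsOpen s)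
    (hbs : P.body ⊆ s) {w : EuclideanSpace ℝ (Fin m) → ℝ} (hw : ConvexOn ℝ s w)
    (hd : ContDiffOn ℝ ∞ w s) {c : ℝ} (hc : 0 ≤ c) :
    (fun x => P.canonicalPotential x + c * w x) ∈ P.potentials := by
  have hint : interior P.body ⊆ s := interior_subset.trans hbs
  have hcw : ContDiffOn ℝ ∞ (fun x => c * w x) s := contDiffOn_const.mul hd
  have hcv : ConvexOn ℝ s (fun x => c * w x) := hw.smul hc
  have hpsd : ∀ x ∈ P.body, (hess (fun x => c * w x) x).PosSemidef := fun x hx =>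
    posSemidef_hess hs hcv hcw (hbs hx)
  refine ⟨P.continuous_canonicalPotential.continuousOn.add (hcw.continuousOn.mono hbs),
    P.contDiffOn_canonicalPotential.add (hcw.mono hint),
    P.strictConvexOn_canonicalPotential.add_convexOn (hcv.subset hint P.convex_body.interior),
    _, P.isCompatible_saddleInv hpsd fun i j => (contDiffOn_hess hs hcw i j).mono hbs,
    fun x hx => ?_⟩
  have hw2 : ContDiffAt ℝ 2 w x := (hd.contDiffAt (hs.mem_nhds (hint hx))).of_le two_le_infty
  have hc2 : ContDiffAt ℝ 2 P.canonicalPotential x :=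
    (P.contDiffOn_canonicalPotential.contDiffAt (isOpen_interior.mem_nhds hx)).of_le two_le_infty
  rw [P.saddleInv_eq_inv (hpsd x (interior_subset hx)) hx, hess_add_smul hc2 hw2,
    hess_const_mul hw2, P.hess_canonicalPotential hx]

end LabelledPolytope

namespace LabelledPolytope

variable {m : ℕ} (P : LabelledPolytope m)

/-! ### Cone decomposition: interior integrals against boundary integrals -/

section Radial

/-- The projection onto the hyperplane `L_j = 0` along `n_j`. -/
noncomputable def facetProj (j : Fin P.d) (x : EuclideanSpace ℝ (Fin m)) :
    EuclideanSpace ℝ (Fin m) :=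
  x - P.L j x • ((‖P.normal j‖ ^ 2)⁻¹ • P.normal j)

lemma L_add_smul_normal (j : Fin P.d) (x : EuclideanSpace ℝ (Fin m)) (t : ℝ) :
    P.L j (x + t • ((‖P.normal j‖ ^ 2)⁻¹ • P.normal j)) = P.L j x + t := by
  have : ‖P.normal j‖ ^ 2 ≠ 0 := pow_ne_zero _ (norm_ne_zero_iff.2 (P.normal_ne_zero j))
  rw [P.L_add, inner_smul_right, inner_smul_right, real_inner_self_eq_norm_sq,
    inv_mul_cancel₀ this, mul_one]

lemma L_facetProj (j : Fin P.d) (x : EuclideanSpace ℝ (Fin m)) : P.L j (P.facetProj j x) = 0 := by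
  rw [facetProj, sub_eq_add_neg, ← neg_smul, P.L_add_smul_normal]; ring

lemma contDiff_facetProj (j : Fin P.d) : ContDiff ℝ ∞ (P.facetProj j) :=
  contDiff_id.sub ((P.contDiff_L j).smul contDiff_const)

/-- The prism of height one over the facet `F_j`. -/
def prism (j : Fin P.d) : Set (EuclideanSpace ℝ (Fin m)) :=
  {x | (0 ≤ P.L j x ∧ P.L j x ≤ 1) ∧ P.facetProj j x ∈ P.facet j}

lemma isCompact_prism (j : Fin P.d) : IsCompact (P.prism j) := by
  have hc : IsCompact ((fun p : EuclideanSpace ℝ (Fin m) × ℝ =>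
      p.1 + p.2 • ((‖P.normal j‖ ^ 2)⁻¹ • P.normal j)) '' (P.facet j ×ˢ Set.Icc (0 : ℝ) 1)) :=
    ((P.isCompact_facet j).prod isCompact_Icc).image (by fun_prop)
  refine hc.of_isClosed_subset ?_ ?_
  · exact ((isClosed_le continuous_const (P.continuous_L j)).inter
      (isClosed_le (P.continuous_L j) continuous_const)).inter
      ((P.isCompact_facet j).isClosed.preimage (P.contDiff_facetProj j).continuous)
  · rintro x ⟨h, hx⟩
    exact ⟨(_, P.L j x), ⟨hx, h⟩, by simp⟩

/-- A facet integral becomes a Lebesgue integral over a solid prism, which a change of variables can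
compare with the cone over the facet. -/
lemma lintegral_facetMeasure (j : Fin P.d) {g : EuclideanSpace ℝ (Fin m) → ENNReal}
    (hg : Measurable g) :
    ∫⁻ x, g x ∂P.facetMeasure j = ∫⁻ x in P.prism j, g (P.facetProj j x) := by
  have hπ : Measurable (P.facetProj j) := (P.contDiff_facetProj j).continuous.measurable
  have hF := (P.isCompact_facet j).measurableSet
  have e : P.facetMeasure j = ((volume.restrict (P.prism j)).map (P.facetProj j)) := by
    rw [facetMeasure]
    change ((volume.restrict _).map (P.facetProj j)).restrict _ = _
    rw [Measure.restrict_map hπ hF, Measure.restrict_restrict (hπ hF), Set.inter_comm]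
    rfl
  rw [e, lintegral_map hg hπ]

/-- The map from the prism over `F_j` onto the cone with base `F_j` and apex `x₀`. -/
noncomputable def coneMap (x₀ : EuclideanSpace ℝ (Fin m)) (j : Fin P.d)
    (x : EuclideanSpace ℝ (Fin m)) : EuclideanSpace ℝ (Fin m) :=
  x₀ + (1 - P.L j x) • (P.facetProj j x - x₀)

lemma contDiff_coneMap (x₀ : EuclideanSpace ℝ (Fin m)) (j : Fin P.d) :
    ContDiff ℝ ∞ (P.coneMap x₀ j) :=
  contDiff_const.add ((contDiff_const.sub (P.contDiff_L j)).smul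
    ((P.contDiff_facetProj j).sub contDiff_const))

lemma L_coneMap (x₀ : EuclideanSpace ℝ (Fin m)) (j : Fin P.d) (x : EuclideanSpace ℝ (Fin m)) :
    P.L j (P.coneMap x₀ j x) = P.L j x * P.L j x₀ := by
  rw [coneMap, P.L_dilation, P.L_facetProj]; ring

/-- The label of the image recovers the height, and then the base point. The top $L_j=1$ is excluded
because it collapses to the apex. -/
lemma injOn_coneMap {x₀ : EuclideanSpace ℝ (Fin m)} (hx₀ : x₀ ∈ interior P.body) (j : Fin P.d) :
    Set.InjOn (P.coneMap x₀ j) {x | P.L j x < 1} := by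
  intro x hx y _ hxy
  have h0 := P.mem_interior_body.1 hx₀ j
  have hL : P.L j x = P.L j y := by
    have := congrArg (P.L j) hxy
    rw [P.L_coneMap, P.L_coneMap] at this
    exact mul_right_cancel₀ h0.ne' this
  have h1 : (1 - P.L j x) ≠ 0 := (sub_pos.2 hx).ne'
  simp only [coneMap, ← hL] at hxy
  have h2 : P.facetProj j x = P.facetProj j y :=
    sub_left_injective (smul_right_injective _ h1 (add_left_cancel hxy))
  simp only [facetProj, ← hL] at h2
  exact sub_left_injective h2

/-- The ray from $x_0$ through $z$ leaves $\triangle$ through the facet that minimizes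
$t=L_j(z)/L_j(x_0)$, at $y=x_0+(1-t)^{-1}(z-x_0)$. The preimage of $z$ is the point of height $t$
above $y$. -/
lemma exists_mem_coneMap_image {x₀ z : EuclideanSpace ℝ (Fin m)} (hx₀ : x₀ ∈ interior P.body)
    (hz : z ∈ P.body) (hne : z ≠ x₀) :
    ∃ j, z ∈ P.coneMap x₀ j '' (P.prism j ∩ {x | P.L j x < 1}) := by
  have h0 := P.mem_interior_body.1 hx₀
  obtain ⟨i, hi⟩ : ∃ i, P.L i z < P.L i x₀ := by
    by_contra hcon
    push Not at hcon
    refine hne (sub_eq_zero.1 (P.eq_zero_of_inner_nonneg fun j => ?_))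
    have := hcon j
    simp only [L] at this
    rw [inner_sub_right]; linarith
  obtain ⟨j, -, hj⟩ := Finset.exists_min_image Finset.univ (fun j => P.L j z / P.L j x₀)
    ⟨i, Finset.mem_univ i⟩
  set t := P.L j z / P.L j x₀ with ht
  have ht0 : 0 ≤ t := div_nonneg (hz j) (h0 j).le
  have ht1 : t < 1 := (hj i (Finset.mem_univ i)).trans_lt ((div_lt_one (h0 i)).2 hi)
  have ht1' : 0 < 1 - t := sub_pos.2 ht1
  have htj : t * P.L j x₀ = P.L j z := div_mul_cancel₀ _ (h0 j).ne'
  have hti : ∀ k, t * P.L k x₀ ≤ P.L k z := fun k =>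
    (le_div_iff₀ (h0 k)).1 (hj k (Finset.mem_univ k))
  set y := x₀ + (1 - t)⁻¹ • (z - x₀) with hy
  have hyL : ∀ k, P.L k y = (1 - t)⁻¹ * (P.L k z - t * P.L k x₀) := fun k => by
    rw [hy, P.L_dilation]; field_simp; ring
  have hyF : y ∈ P.facet j :=
    ⟨fun k => by rw [hyL]; exact mul_nonneg (inv_nonneg.2 ht1'.le) (sub_nonneg.2 (hti k)),
      by rw [hyL, htj, sub_self, mul_zero]⟩
  set x := y + t • ((‖P.normal j‖ ^ 2)⁻¹ • P.normal j) with hx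
  have hxL : P.L j x = t := by rw [hx, P.L_add_smul_normal, hyF.2, zero_add]
  have hxπ : P.facetProj j x = y := by rw [facetProj, hxL, hx, add_sub_cancel_right]
  refine ⟨j, x, ⟨⟨⟨hxL ▸ ht0, hxL ▸ ht1.le⟩, hxπ ▸ hyF⟩, by
    change P.L j x < 1; rw [hxL]; exact ht1⟩, ?_⟩
  rw [coneMap, hxπ, hxL, hy, add_sub_cancel_left, smul_smul, mul_inv_cancel₀ ht1'.ne', one_smul,
    add_sub_cancel]

/-- A function that increases along the rays from `x₀` is dominated in the mean by its boundary
values. -/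
lemma exists_lintegral_body_le (hm : 1 ≤ m) {x₀ : EuclideanSpace ℝ (Fin m)}
    (hx₀ : x₀ ∈ interior P.body) :
    ∃ C : NNReal, ∀ g : EuclideanSpace ℝ (Fin m) → ENNReal, Measurable g →
      (∀ y ∈ P.body, ∀ r : ℝ, 0 ≤ r → r ≤ 1 → g (x₀ + r • (y - x₀)) ≤ g y) →
      ∫⁻ x in P.body, g x ≤ C * ∫⁻ x, g x ∂P.boundaryMeasure := by
  -- Positive dimension makes the apex, which no cone image needs to cover, a null set.
  have : Nonempty (Fin m) := ⟨⟨0, hm⟩⟩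
  have hdet : ∀ j, ∃ C : NNReal, ∀ x ∈ P.prism j,
      ENNReal.ofReal |(fderiv ℝ (P.coneMap x₀ j) x).det| ≤ C := fun j => by
    have hc : Continuous fun x => |(fderiv ℝ (P.coneMap x₀ j) x).det| :=
      (ContinuousLinearMap.continuous_det.comp
        ((P.contDiff_coneMap x₀ j).continuous_fderiv (by simp))).abs
    obtain ⟨C, hC⟩ := (P.isCompact_prism j).bddAbove_image hc.continuousOn
    exact ⟨C.toNNReal, fun x hx => ENNReal.ofReal_le_ofReal (hC ⟨x, hx, rfl⟩)⟩
  choose C hC using hdet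
  refine ⟨∑ j, C j, fun g hg hmono => ?_⟩
  have hlt : ∀ j, MeasurableSet (P.prism j ∩ {x | P.L j x < 1}) := fun j =>
    (P.isCompact_prism j).measurableSet.inter
      (isOpen_lt (P.continuous_L j) continuous_const).measurableSet
  have hcone : ∀ j, ∫⁻ x in P.coneMap x₀ j '' (P.prism j ∩ {x | P.L j x < 1}), g x
      ≤ C j * ∫⁻ x, g x ∂P.facetMeasure j := fun j => by
    rw [lintegral_image_eq_lintegral_abs_det_fderiv_mul volume (hlt j)
      (fun x _ => ((P.contDiff_coneMap x₀ j).differentiable (by simp) x).hasFDerivAt.hasFDerivWithinAt)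
      ((P.injOn_coneMap hx₀ j).mono Set.inter_subset_right), P.lintegral_facetMeasure j hg,
      ← lintegral_const_mul' _ _ ENNReal.coe_ne_top]
    -- The Jacobian is bounded on the compact prism, and `g` at a point of the cone is at most its
    -- value at the base point of the same ray.
    refine (setLIntegral_mono_ae' (hlt j) (.of_forall fun x hx => ?_)).trans
      (lintegral_mono_set Set.inter_subset_left)
    exact mul_le_mul' (hC j x hx.1) (hmono _ hx.1.2.1 _ (sub_nonneg.2 hx.1.1.2)
      (by linarith [hx.1.1.1]))
  have hcover : P.body ⊆ {x₀} ∪ ⋃ j, P.coneMap x₀ j '' (P.prism j ∩ {x | P.L j x < 1}) := by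
    intro z hz
    by_cases h : z = x₀
    · exact Or.inl h
    · exact Or.inr (Set.mem_iUnion.2 (P.exists_mem_coneMap_image hx₀ hz h))
  calc ∫⁻ x in P.body, g x
      ≤ ∫⁻ x in {x₀} ∪ ⋃ j, P.coneMap x₀ j '' (P.prism j ∩ {x | P.L j x < 1}), g x :=
        lintegral_mono_set hcover
    _ ≤ (∫⁻ x in {x₀}, g x)
        + ∫⁻ x in ⋃ j, P.coneMap x₀ j '' (P.prism j ∩ {x | P.L j x < 1}), g x :=
        lintegral_union_le _ _ _
    _ = ∫⁻ x in ⋃ j, P.coneMap x₀ j '' (P.prism j ∩ {x | P.L j x < 1}), g x := by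
        rw [setLIntegral_measure_zero _ _ (measure_singleton x₀), zero_add]
    _ ≤ ∑ j, ∫⁻ x in P.coneMap x₀ j '' (P.prism j ∩ {x | P.L j x < 1}), g x := by
        exact (lintegral_iUnion_le _ _).trans_eq (tsum_fintype _)
    _ ≤ ∑ j, (∑ i, C i : NNReal) * ∫⁻ x, g x ∂P.facetMeasure j := by
        refine Finset.sum_le_sum fun j _ => (hcone j).trans (mul_le_mul_left ?_ _)
        exact ENNReal.coe_le_coe.2 (Finset.single_le_sum (f := C) (fun _ _ => zero_le)
          (Finset.mem_univ j))
    _ = _ := by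
        rw [← Finset.mul_sum, boundaryMeasure, lintegral_finsetSum_measure]

end Radial

/-! ### Integrability of the logarithms of the labels -/

section LogIntegrability

lemma volume_body_lt_top : volume P.body < ⊤ := P.isCompact_body.measure_lt_top

/-- The layer misses the copy of $\triangle$ shrunk towards $x_0$ by the factor $1-\tau$, and
$1-(1-\tau)^m\le m\tau$ by Bernoulli's inequality. -/
lemma volume_L_lt_le {x₀ : EuclideanSpace ℝ (Fin m)} (hx₀ : x₀ ∈ interior P.body) (j : Fin P.d)
    {τ : ℝ} (h0 : 0 < τ) (h1 : τ ≤ 1) :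
    volume {x ∈ P.body | P.L j x < τ * P.L j x₀} ≤ ENNReal.ofReal (m * τ) * volume P.body := by
  set D := AffineMap.homothety x₀ (1 - τ) '' P.body with hD
  have hhom : ∀ y, AffineMap.homothety x₀ (1 - τ) y = x₀ + (1 - τ) • (y - x₀) := fun y => by
    rw [AffineMap.homothety_apply, vsub_eq_sub, vadd_eq_add, add_comm]
  have hDb : D ⊆ P.body := by
    rintro _ ⟨y, hy, rfl⟩
    rw [hhom]
    exact P.dilation_mem_body (interior_subset hx₀) hy (by linarith) (by linarith)
  have hsub : {x ∈ P.body | P.L j x < τ * P.L j x₀} ⊆ P.body \ D := by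
    rintro x ⟨hx, hlt⟩
    refine ⟨hx, ?_⟩
    rintro ⟨y, hy, rfl⟩
    rw [hhom, P.L_dilation] at hlt
    have := mul_nonneg (sub_nonneg.2 h1) (hy j)
    linarith
  have hDc : IsCompact D := P.isCompact_body.image (AffineMap.homothety_continuous _ _)
  refine (measure_mono hsub).trans ?_
  rw [measure_sdiff hDb hDc.measurableSet.nullMeasurableSet hDc.measure_lt_top.ne,
    tsub_le_iff_right, hD, Measure.addHaar_image_homothety, ← add_mul,
    ← ENNReal.ofReal_add (by positivity) (abs_nonneg _)]
  have hb := one_add_mul_le_pow (a := -τ) (by linarith) m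
  have h3 : (1 : ℝ) ≤ m * τ + |(1 - τ) ^ Module.finrank ℝ (EuclideanSpace ℝ (Fin m))| := by
    rw [finrank_euclideanSpace_fin, abs_of_nonneg (pow_nonneg (by linarith) _)]
    rw [← sub_eq_add_neg] at hb
    linarith
  exact le_mul_of_one_le_left' (by simpa using ENNReal.ofReal_le_ofReal h3)

/-- By the layer cake formula: the superlevel set at height $t$ is a layer of width $\tau=e^{-t}$,
so its volume decays exponentially. -/
lemma lintegral_neg_log_L_lt_top {x₀ : EuclideanSpace ℝ (Fin m)} (hx₀ : x₀ ∈ interior P.body)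
    (j : Fin P.d) :
    ∫⁻ x in P.body, ENNReal.ofReal (max (-Real.log (P.L j x / P.L j x₀)) 0) < ⊤ := by
  have h0 := P.mem_interior_body.1 hx₀ j
  have hmeas : Measurable fun x => max (-Real.log (P.L j x / P.L j x₀)) 0 :=
    (Real.measurable_log.comp ((P.continuous_L j).measurable.div_const _)).neg.max
      measurable_const
  have hnn : 0 ≤ᵐ[volume.restrict P.body] fun x => max (-Real.log (P.L j x / P.L j x₀)) 0 :=
    .of_forall fun x => le_max_right _ _
  rw [lintegral_eq_lintegral_meas_lt _ hnn hmeas.aemeasurable]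
  have hle : ∀ t ∈ Set.Ioi (0 : ℝ),
      (volume.restrict P.body) {x | t < max (-Real.log (P.L j x / P.L j x₀)) 0}
        ≤ ENNReal.ofReal (Real.exp (-t)) * (ENNReal.ofReal m * volume P.body) := by
    intro t (ht : 0 < t)
    rw [Measure.restrict_apply (measurableSet_lt measurable_const hmeas)]
    refine (measure_mono ?_).trans ((P.volume_L_lt_le hx₀ j (Real.exp_pos (-t))
      (Real.exp_le_one_iff.2 (by linarith))).trans_eq ?_)
    · rintro x ⟨hx, hxb⟩
      refine ⟨hxb, ?_⟩
      have h1 : t < -Real.log (P.L j x / P.L j x₀) :=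
        (lt_max_iff.1 hx).resolve_right (not_lt.2 ht.le)
      have hpos : 0 < P.L j x / P.L j x₀ := by
        refine (div_nonneg (hxb j) h0.le).lt_of_ne' fun h => ?_
        rw [h, Real.log_zero] at h1
        linarith
      rw [← div_lt_iff₀ h0]
      exact (Real.log_lt_iff_lt_exp hpos).1 (by linarith)
    · rw [mul_comm (m : ℝ), ENNReal.ofReal_mul (Real.exp_pos _).le, mul_assoc]
  refine (setLIntegral_mono' measurableSet_Ioi hle).trans_lt ?_
  rw [lintegral_mul_const _ (by fun_prop)]
  refine ENNReal.mul_lt_top ?_ (ENNReal.mul_lt_top ENNReal.ofReal_lt_top P.volume_body_lt_top)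
  have hint := integrableOn_exp_neg_Ioi 0
  rw [← ofReal_integral_eq_lintegral_ofReal hint (.of_forall fun t => (Real.exp_pos _).le)]
  exact ENNReal.ofReal_lt_top

lemma integrableOn_abs_log_L (j : Fin P.d) :
    IntegrableOn (fun x => |Real.log (P.L j x)|) P.body := by
  obtain ⟨x₀, hx₀⟩ := P.interior_body_nonempty
  have h0 := P.mem_interior_body.1 hx₀ j
  have hmeas : Measurable fun x => max (-Real.log (P.L j x / P.L j x₀)) 0 :=
    (Real.measurable_log.comp ((P.continuous_L j).measurable.div_const _)).neg.max
      measurable_const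
  have hmax : IntegrableOn (fun x => max (-Real.log (P.L j x / P.L j x₀)) 0) P.body := by
    refine ⟨hmeas.aestronglyMeasurable, ?_⟩
    have hnn : 0 ≤ᵐ[volume.restrict P.body] fun x => max (-Real.log (P.L j x / P.L j x₀)) 0 :=
      .of_forall fun x => le_max_right _ _
    rw [hasFiniteIntegral_iff_ofReal hnn]
    exact P.lintegral_neg_log_L_lt_top hx₀ j
  have hφ : IntegrableOn (fun x => P.L j x / P.L j x₀ + |Real.log (P.L j x₀)|) P.body :=
    ((P.continuous_L j).div_const _ |>.add continuous_const).continuousOn.integrableOn_compact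
      P.isCompact_body
  refine Integrable.mono' ((hmax.const_mul 2).add hφ)
    ((Real.measurable_log.comp (P.continuous_L j).measurable).abs.aestronglyMeasurable) ?_
  filter_upwards [ae_restrict_mem P.isClosed_body.measurableSet] with x hx
  simp only [Pi.add_apply, norm_abs_eq_norm, Real.norm_eq_abs]
  rcases (hx j).eq_or_lt with h | h
  · rw [← h]; simp
  · have e : Real.log (P.L j x) = Real.log (P.L j x / P.L j x₀) + Real.log (P.L j x₀) := by
      rw [Real.log_div h.ne' h0.ne']; ring
    have h1 : Real.log (P.L j x / P.L j x₀) ≤ P.L j x / P.L j x₀ :=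
      Real.log_le_self (div_nonneg h.le h0.le)
    have h2 : |Real.log (P.L j x)|
        ≤ |Real.log (P.L j x / P.L j x₀)| + |Real.log (P.L j x₀)| := by
      rw [e]; exact abs_add_le _ _
    have h3 : 0 ≤ P.L j x / P.L j x₀ := div_nonneg h.le h0.le
    rcases le_total 0 (Real.log (P.L j x / P.L j x₀)) with h4 | h4
    · rw [abs_of_nonneg h4] at h2
      rw [max_eq_right (by linarith)]
      linarith
    · rw [abs_of_nonpos h4] at h2
      rw [max_eq_left (by linarith)]
      linarith

end LogIntegrability

end LabelledPolytope

/-! ### Approximation by dilation -/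

/-- The function obtained from `u` by the dilation with centre `x₀` and ratio `r`. -/
def dilate {m : ℕ} (x₀ : EuclideanSpace ℝ (Fin m)) (r : ℝ) (u : EuclideanSpace ℝ (Fin m) → ℝ)
    (x : EuclideanSpace ℝ (Fin m)) : ℝ :=
  u (x₀ + r • (x - x₀))

lemma contDiff_dilation {m : ℕ} (x₀ : EuclideanSpace ℝ (Fin m)) (r : ℝ) :
    ContDiff ℝ ∞ fun x : EuclideanSpace ℝ (Fin m) => x₀ + r • (x - x₀) :=
  contDiff_const.add ((contDiff_id.sub contDiff_const).const_smul r)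

namespace LabelledPolytope

variable {m : ℕ} (P : LabelledPolytope m)

section Dilate

variable {P} {x₀ : EuclideanSpace ℝ (Fin m)} {u : EuclideanSpace ℝ (Fin m) → ℝ}

lemma dilate_nonneg (hx₀ : x₀ ∈ interior P.body) (hu : u ∈ P.CTilde x₀) {r : ℝ} (h0 : 0 ≤ r)
    (h1 : r ≤ 1) {x : EuclideanSpace ℝ (Fin m)} (hx : x ∈ P.body) : 0 ≤ dilate x₀ r u x :=
  hu.2.2 _ (P.dilation_mem_body (interior_subset hx₀) hx h0 h1)

lemma dilate_le (hx₀ : x₀ ∈ interior P.body) (hu : u ∈ P.CTilde x₀) {r : ℝ} (h0 : 0 ≤ r)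
    (h1 : r ≤ 1) {x : EuclideanSpace ℝ (Fin m)} (hx : x ∈ P.body) : dilate x₀ r u x ≤ u x := by
  have h := hu.1.2.1.2 (interior_subset hx₀) hx (sub_nonneg.2 h1) h0 (by ring)
  have e : (1 - r) • x₀ + r • x = x₀ + r • (x - x₀) := by module
  rw [e, hu.2.1, smul_zero, zero_add, smul_eq_mul] at h
  exact h.trans (mul_le_of_le_one_left (hu.2.2 x hx) h1)

variable (P x₀) in
/-- The preimage of the interior of `△` under a dilation. -/
def dilateDomain (r : ℝ) : Set (EuclideanSpace ℝ (Fin m)) :=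
  (fun x => x₀ + r • (x - x₀)) ⁻¹' interior P.body

lemma isOpen_dilateDomain (r : ℝ) : IsOpen (P.dilateDomain x₀ r) :=
  isOpen_interior.preimage (contDiff_dilation x₀ r).continuous

lemma body_subset_dilateDomain (hx₀ : x₀ ∈ interior P.body) {r : ℝ} (h0 : 0 ≤ r) (h1 : r < 1) :
    P.body ⊆ P.dilateDomain x₀ r := fun _ hx => P.dilation_mem_interior hx₀ hx h0 h1

lemma convexOn_dilate (hu : u ∈ P.CTilde x₀) (r : ℝ) :
    ConvexOn ℝ (P.dilateDomain x₀ r) (dilate x₀ r u) := by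
  have e : ∀ x, AffineMap.homothety x₀ r x = x₀ + r • (x - x₀) := fun y => by
    rw [AffineMap.homothety_apply, vsub_eq_sub, vadd_eq_add, add_comm]
  have h := (hu.1.2.1.subset interior_subset P.convex_body.interior).comp_affineMap
    (AffineMap.homothety x₀ r)
  have e' : ⇑(AffineMap.homothety x₀ r) = fun x => x₀ + r • (x - x₀) := funext e
  rw [e'] at h
  exact h

lemma contDiffOn_dilate (hu : u ∈ P.CTilde x₀) (r : ℝ) :
    ContDiffOn ℝ ∞ (dilate x₀ r u) (P.dilateDomain x₀ r) :=
  hu.1.2.2.comp (contDiff_dilation x₀ r).contDiffOn fun _ hx => hx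

lemma tendsto_dilate (hx₀ : x₀ ∈ interior P.body) (hu : ContinuousOn u P.body) {r : ℕ → ℝ}
    (hr0 : ∀ n, 0 ≤ r n) (hr1 : ∀ n, r n < 1) (hr : Filter.Tendsto r Filter.atTop (nhds 1))
    {x : EuclideanSpace ℝ (Fin m)} (hx : x ∈ P.body) :
    Filter.Tendsto (fun n => dilate x₀ (r n) u x) Filter.atTop (nhds (u x)) := by
  have hpt : Filter.Tendsto (fun n => x₀ + r n • (x - x₀)) Filter.atTop (nhds x) := by
    simpa using (hr.smul_const (x - x₀)).const_add x₀
  exact (hu x hx).tendsto.comp (tendsto_nhdsWithin_iff.2 ⟨hpt, .of_forall fun n =>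
    P.dilation_mem_body (interior_subset hx₀) hx (hr0 n) (hr1 n).le⟩)

end Dilate

/-! ### A cutoff function with integrable logarithm -/

section Bump

lemma hasDerivAt_max_zero_pow (n : ℕ) (t : ℝ) :
    HasDerivAt (fun t : ℝ => max t 0 ^ (n + 2)) ((n + 2 : ℕ) * max t 0 ^ (n + 1)) t := by
  rcases lt_trichotomy t 0 with h | rfl | h
  · rw [max_eq_right h.le, zero_pow (Nat.succ_ne_zero _), mul_zero]
    refine (hasDerivAt_const t (0 : ℝ)).congr_of_eventuallyEq ?_
    filter_upwards [Iio_mem_nhds h] with y (hy : y < 0)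
    rw [max_eq_right hy.le, zero_pow (Nat.succ_ne_zero _)]
  · rw [max_self, zero_pow (Nat.succ_ne_zero _), mul_zero, ← hasDerivWithinAt_univ,
      ← Set.Iic_union_Ici (a := (0 : ℝ))]
    refine HasDerivWithinAt.union ?_ ?_
    · refine (hasDerivWithinAt_const (0 : ℝ) _ (0 : ℝ)).congr (fun y (hy : y ≤ 0) => ?_) (by simp)
      rw [max_eq_right hy, zero_pow (Nat.succ_ne_zero _)]
    · have := (hasDerivAt_pow (n + 2) (0 : ℝ)).hasDerivWithinAt (s := Set.Ici 0)
      simp only [Nat.add_one_sub_one, zero_pow (Nat.succ_ne_zero _), mul_zero] at this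
      exact this.congr (fun y (hy : 0 ≤ y) => by rw [max_eq_left hy]) (by simp)
  · rw [max_eq_left h.le]
    refine (hasDerivAt_pow (n + 2) t).congr_of_eventuallyEq ?_
    filter_upwards [Ioi_mem_nhds h] with y (hy : 0 < y)
    rw [max_eq_left hy.le]

/-- The cube is the least integer power that is $C^2$ across zero, as two integrations by parts
require. A power, unlike a flat cutoff, has a logarithm that is a multiple of $\log L_j$, hence
integrable. -/
lemma contDiff_max_zero_cube : ContDiff ℝ 2 (fun t : ℝ => max t 0 ^ 3) := by
  have d1 : ∀ n : ℕ, deriv (fun t : ℝ => max t 0 ^ (n + 2))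
      = fun t : ℝ => ((n + 2 : ℕ) : ℝ) * max t 0 ^ (n + 1) := fun n =>
    funext fun t => (hasDerivAt_max_zero_pow n t).deriv
  have c1 : ContDiff ℝ 1 (fun t : ℝ => max t 0 ^ 2) := by
    rw [contDiff_one_iff_deriv]
    refine ⟨fun t => (hasDerivAt_max_zero_pow 0 t).differentiableAt, ?_⟩
    rw [show (fun t : ℝ => max t 0 ^ 2) = fun t => max t 0 ^ (0 + 2) from rfl, d1]
    fun_prop
  rw [show (2 : WithTop ℕ∞) = 1 + 1 by norm_num, contDiff_succ_iff_deriv]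
  refine ⟨fun t => (hasDerivAt_max_zero_pow 1 t).differentiableAt, by simp, ?_⟩
  rw [show (fun t : ℝ => max t 0 ^ 3) = fun t => max t 0 ^ (1 + 2) from rfl, d1]
  exact contDiff_const.mul c1

/-- A `C²` function that is positive on the interior of `△` and vanishes elsewhere. -/
noncomputable def bump (x : EuclideanSpace ℝ (Fin m)) : ℝ := ∏ j, max (P.L j x) 0 ^ 3

lemma contDiff_bump : ContDiff ℝ 2 P.bump :=
  contDiff_prod fun j _ => contDiff_max_zero_cube.comp ((P.contDiff_L j).of_le two_le_infty)

lemma bump_nonneg (x : EuclideanSpace ℝ (Fin m)) : 0 ≤ P.bump x :=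
  Finset.prod_nonneg fun _ _ => pow_nonneg (le_max_right _ _) _

lemma bump_pos {x : EuclideanSpace ℝ (Fin m)} (hx : x ∈ interior P.body) : 0 < P.bump x :=
  Finset.prod_pos fun j _ => pow_pos (lt_max_of_lt_left (P.mem_interior_body.1 hx j)) _

lemma bump_eq_zero {x : EuclideanSpace ℝ (Fin m)} (hx : x ∉ P.body) : P.bump x = 0 := by
  obtain ⟨j, hj⟩ : ∃ j, P.L j x < 0 := by simpa [body] using hx
  exact Finset.prod_eq_zero (Finset.mem_univ j) (by rw [max_eq_right hj.le]; norm_num)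

lemma tsupport_subset_body {E : Type*} [Zero E] {h : EuclideanSpace ℝ (Fin m) → E}
    (hh : ∀ x ∉ P.body, h x = 0) : tsupport h ⊆ P.body :=
  closure_minimal (fun x hx => by_contra fun hn => hx (hh x hn)) P.isClosed_body

lemma fderiv_eq_zero_of_notMem_body {E : Type*} [NormedAddCommGroup E] [NormedSpace ℝ E]
    {h : EuclideanSpace ℝ (Fin m) → E} (hh : ∀ x ∉ P.body, h x = 0)
    {x : EuclideanSpace ℝ (Fin m)} (hx : x ∉ P.body) : fderiv ℝ h x = 0 := by
  have : h =ᶠ[nhds x] fun _ => 0 := by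
    filter_upwards [P.isClosed_body.isOpen_compl.mem_nhds hx] with y hy using hh y hy
  rw [this.fderiv_eq]; simp

lemma abs_log_bump_le {x : EuclideanSpace ℝ (Fin m)} (hx : x ∈ interior P.body) :
    |Real.log (P.bump x)| ≤ ∑ j, 3 * |Real.log (P.L j x)| := by
  have hL := P.mem_interior_body.1 hx
  have e : Real.log (P.bump x) = ∑ j, 3 * Real.log (P.L j x) := by
    rw [bump, Real.log_prod fun j _ => (pow_pos (lt_max_of_lt_left (hL j)) _).ne']
    refine Finset.sum_congr rfl fun j _ => ?_
    rw [max_eq_left (hL j).le, Real.log_pow]; norm_num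
  rw [e]
  refine (Finset.abs_sum_le_sum_abs _ _).trans (Finset.sum_le_sum fun j _ => ?_)
  rw [abs_mul]; norm_num

end Bump

/-! ### Integration by parts and the weighted Laplacian -/

section IntegrationByParts

lemma integrable_of_continuousOn_body {h : EuclideanSpace ℝ (Fin m) → ℝ}
    (hc : ContinuousOn h P.body) (hh : ∀ x ∉ P.body, h x = 0) : Integrable h := by
  rw [← integrableOn_iff_integrable_of_support_subset
    (fun x hx => by_contra fun hn => hx (hh x hn) : Function.support h ⊆ P.body)]
  exact hc.integrableOn_compact P.isCompact_body

/-- The cutoff and its first two derivatives vanish off $\triangle$, so two integrations by parts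
over the whole space leave no boundary terms; `u` has to be smooth only near $\triangle$. -/
lemma integral_bump_mul_fderiv_fderiv {s : Set (EuclideanSpace ℝ (Fin m))} (hs : IsOpen s)
    (hbs : P.body ⊆ s) {u : EuclideanSpace ℝ (Fin m) → ℝ} (hu : ContDiffOn ℝ ∞ u s)
    (v : EuclideanSpace ℝ (Fin m)) :
    ∫ x, P.bump x * fderiv ℝ (fderiv ℝ u) x v v
      = ∫ x, fderiv ℝ (fderiv ℝ P.bump) x v v * u x := by
  have hu1 := hu.fderiv_of_isOpen hs (m := ∞) (by simp)
  have hu2 := hu1.fderiv_of_isOpen hs (m := ∞) (by simp)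
  have hψ := P.contDiff_bump
  have hψ1 : ContDiff ℝ 1 (fderiv ℝ P.bump) := hψ.fderiv_right (by norm_num)
  have hψ2 : Continuous (fderiv ℝ (fderiv ℝ P.bump)) := hψ1.continuous_fderiv (by simp)
  have z0 : ∀ x ∉ P.body, P.bump x = 0 := fun x hx => P.bump_eq_zero hx
  have z1 : ∀ x ∉ P.body, fderiv ℝ P.bump x = 0 := fun x hx =>
    P.fderiv_eq_zero_of_notMem_body z0 hx
  have z2 : ∀ x ∉ P.body, fderiv ℝ (fderiv ℝ P.bump) x = 0 := fun x hx =>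
    P.fderiv_eq_zero_of_notMem_body z1 hx
  have du1 : ∀ x ∈ s, DifferentiableAt ℝ (fderiv ℝ u) x := fun x hx =>
    (hu1.contDiffAt (hs.mem_nhds hx)).differentiableAt (by simp)
  have dψ1 : Differentiable ℝ (fderiv ℝ P.bump) := hψ1.differentiable (by simp)
  have eu : ∀ x ∈ s, fderiv ℝ (fun y => fderiv ℝ u y v) x v = fderiv ℝ (fderiv ℝ u) x v v :=
    fun x hx => by
      rw [fderiv_clm_apply (du1 x hx) (differentiableAt_const v)]; simp
  have eψ : ∀ x, fderiv ℝ (fun y => fderiv ℝ P.bump y v) x v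
      = fderiv ℝ (fderiv ℝ P.bump) x v v := fun x => by
    rw [fderiv_clm_apply (dψ1 x) (differentiableAt_const v)]; simp
  have cu : ContinuousOn u P.body := hu.continuousOn.mono hbs
  have cu1 : ContinuousOn (fun x => fderiv ℝ u x v) P.body :=
    (hu1.continuousOn.mono hbs).clm_apply continuousOn_const
  have cu2 : ContinuousOn (fun x => fderiv ℝ (fun y => fderiv ℝ u y v) x v) P.body :=
    (((hu2.continuousOn.mono hbs).clm_apply continuousOn_const).clm_apply
      continuousOn_const).congr fun x hx => eu x (hbs hx)
  have cψ : ContinuousOn P.bump P.body := hψ.continuous.continuousOn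
  have cψ1 : ContinuousOn (fun x => fderiv ℝ P.bump x v) P.body :=
    hψ1.continuous.continuousOn.clm_apply continuousOn_const
  have cψ2 : ContinuousOn (fun x => fderiv ℝ (fun y => fderiv ℝ P.bump y v) x v) P.body := by
    simp only [eψ]
    exact (hψ2.continuousOn.clm_apply continuousOn_const).clm_apply continuousOn_const
  have i1 := integral_mul_fderiv_eq_neg_fderiv_mul_of_integrable (μ := volume)
    (f := P.bump) (g := fun x => fderiv ℝ u x v) (v := v)
    (P.integrable_of_continuousOn_body (cψ1.mul cu1) fun x hx => by simp [z1 x hx])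
    (P.integrable_of_continuousOn_body (cψ.mul cu2) fun x hx => by simp [z0 x hx])
    (P.integrable_of_continuousOn_body (cψ.mul cu1) fun x hx => by simp [z0 x hx])
    (fun x _ => hψ.differentiable (by simp) x)
    (fun x hx => (du1 x (hbs (P.tsupport_subset_body z0 hx))).clm_apply (differentiableAt_const v))
  have i2 := integral_mul_fderiv_eq_neg_fderiv_mul_of_integrable (μ := volume)
    (f := fun x => fderiv ℝ P.bump x v) (g := u) (v := v)
    (P.integrable_of_continuousOn_body (cψ2.mul cu) fun x hx => by simp [eψ, z2 x hx])
    (P.integrable_of_continuousOn_body (cψ1.mul cu1) fun x hx => by simp [z1 x hx])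
    (P.integrable_of_continuousOn_body (cψ1.mul cu) fun x hx => by simp [z1 x hx])
    (fun x _ => (dψ1 x).clm_apply (differentiableAt_const v))
    (fun x hx => (hu.contDiffAt (hs.mem_nhds (hbs (P.tsupport_subset_body
      (fun y hy => by simp [z1 y hy]) hx)))).differentiableAt (by simp))
  have e1 : ∫ x, P.bump x * fderiv ℝ (fderiv ℝ u) x v v
      = ∫ x, P.bump x * fderiv ℝ (fun y => fderiv ℝ u y v) x v := by
    congr 1; ext x
    by_cases hx : x ∈ P.body
    · rw [eu x (hbs hx)]
    · simp [z0 x hx]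
  rw [e1, i1, i2, neg_neg]
  simp only [eψ]

lemma continuousOn_trace_hess {s : Set (EuclideanSpace ℝ (Fin m))} (hs : IsOpen s)
    {u : EuclideanSpace ℝ (Fin m) → ℝ} (hu : ContDiffOn ℝ ∞ u s) :
    ContinuousOn (fun x => (hess u x).trace) s := by
  simp only [Matrix.trace, Matrix.diag]
  exact continuousOn_finsetSum _ fun i _ => (contDiffOn_hess hs hu i i).continuousOn

lemma continuous_trace_hess_bump : Continuous fun x => (hess P.bump x).trace := by
  have hψ1 : ContDiff ℝ 1 (fderiv ℝ P.bump) := P.contDiff_bump.fderiv_right (by norm_num)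
  have hψ2 : Continuous (fderiv ℝ (fderiv ℝ P.bump)) := hψ1.continuous_fderiv (by simp)
  simp only [Matrix.trace, Matrix.diag, hess, Matrix.of_apply]
  exact continuous_finsetSum _ fun i _ =>
    (hψ2.clm_apply continuous_const).clm_apply continuous_const

lemma hess_bump_eq_zero {x : EuclideanSpace ℝ (Fin m)} (hx : x ∉ P.body) :
    hess P.bump x = 0 := by
  have z1 : ∀ x ∉ P.body, fderiv ℝ P.bump x = 0 := fun x hx =>
    P.fderiv_eq_zero_of_notMem_body (fun x hx => P.bump_eq_zero hx) hx
  ext i j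
  simp [hess, P.fderiv_eq_zero_of_notMem_body z1 hx]

lemma integral_bump_mul_trace_hess {s : Set (EuclideanSpace ℝ (Fin m))} (hs : IsOpen s)
    (hbs : P.body ⊆ s) {u : EuclideanSpace ℝ (Fin m) → ℝ} (hu : ContDiffOn ℝ ∞ u s) :
    ∫ x, P.bump x * (hess u x).trace = ∫ x, (hess P.bump x).trace * u x := by
  have hψ1 : ContDiff ℝ 1 (fderiv ℝ P.bump) := P.contDiff_bump.fderiv_right (by norm_num)
  have hψ2 : Continuous (fderiv ℝ (fderiv ℝ P.bump)) := hψ1.continuous_fderiv (by simp)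
  simp only [Matrix.trace, Matrix.diag, Finset.mul_sum, Finset.sum_mul]
  rw [integral_finsetSum, integral_finsetSum]
  · exact Finset.sum_congr rfl fun i _ => P.integral_bump_mul_fderiv_fderiv hs hbs hu _
  · intro i _
    refine P.integrable_of_continuousOn_body ?_ fun x hx => by simp [P.hess_bump_eq_zero hx]
    exact ((hψ2.clm_apply continuous_const).clm_apply continuous_const).continuousOn.mul
      (hu.continuousOn.mono hbs)
  · intro i _
    refine P.integrable_of_continuousOn_body ?_ fun x hx => by simp [P.bump_eq_zero hx]
    exact P.contDiff_bump.continuous.continuousOn.mul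
      ((contDiffOn_hess hs hu i i).continuousOn.mono hbs)

/-- Derivatives of `u` are not controlled at the boundary, so the integration by parts is done for
the dilations, which satisfy $0\le u_r\le u$ on $\triangle$. Fatou's lemma then passes to $r\to1$;
the integrands are nonnegative by convexity. -/
lemma exists_lintegral_bump_mul_trace_hess_le {x₀ : EuclideanSpace ℝ (Fin m)}
    (hx₀ : x₀ ∈ interior P.body) :
    ∃ C : ℝ, 0 ≤ C ∧ ∀ u ∈ P.CTilde x₀,
      ∫⁻ x in interior P.body, ENNReal.ofReal (P.bump x * (hess u x).trace)
        ≤ ENNReal.ofReal (C * ∫ x in P.body, u x) := by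
  obtain ⟨C, hC⟩ := P.isCompact_body.bddAbove_image P.continuous_trace_hess_bump.abs.continuousOn
  have hC' : ∀ x ∈ P.body, |(hess P.bump x).trace| ≤ C := fun x hx => hC ⟨x, hx, rfl⟩
  have hC0 : 0 ≤ C := (abs_nonneg _).trans (hC' x₀ (interior_subset hx₀))
  refine ⟨C, hC0, fun u hu => ?_⟩
  have hub : IntegrableOn u P.body := hu.1.1.integrableOn_compact P.isCompact_body
  have key : ∀ r : ℝ, 0 ≤ r → r < 1 →
      ∫⁻ x in interior P.body, ENNReal.ofReal (P.bump x * (hess (dilate x₀ r u) x).trace)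
        ≤ ENNReal.ofReal (C * ∫ x in P.body, u x) := by
    intro r h0 h1
    have hs := isOpen_dilateDomain (P := P) (x₀ := x₀) r
    have hbs := body_subset_dilateDomain hx₀ h0 h1
    have hd := contDiffOn_dilate hu r
    have hint : Integrable fun x => P.bump x * (hess (dilate x₀ r u) x).trace :=
      P.integrable_of_continuousOn_body (P.contDiff_bump.continuous.continuousOn.mul
        ((continuousOn_trace_hess hs hd).mono hbs)) fun x hx => by simp [P.bump_eq_zero hx]
    have hnn : ∀ x, 0 ≤ P.bump x * (hess (dilate x₀ r u) x).trace := fun x => by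
      by_cases hx : x ∈ P.body
      · exact mul_nonneg (P.bump_nonneg x)
          (posSemidef_hess hs (convexOn_dilate hu r) hd (hbs hx)).trace_nonneg
      · simp [P.bump_eq_zero hx]
    refine (setLIntegral_le_lintegral _ _).trans ?_
    rw [← ofReal_integral_eq_lintegral_ofReal hint (.of_forall hnn),
      P.integral_bump_mul_trace_hess hs hbs hd]
    refine ENNReal.ofReal_le_ofReal ?_
    rw [← setIntegral_eq_integral_of_forall_compl_eq_zero (s := P.body)
      (fun x hx => by simp [P.hess_bump_eq_zero hx]), ← integral_const_mul]
    refine setIntegral_mono_on ?_ (hub.const_mul C) P.isClosed_body.measurableSet fun x hx => ?_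
    · exact (P.continuous_trace_hess_bump.continuousOn.mul
        (hd.continuousOn.mono hbs)).integrableOn_compact P.isCompact_body
    · exact mul_le_mul ((le_abs_self _).trans (hC' x hx)) (dilate_le hx₀ hu h0 h1.le hx)
        (dilate_nonneg hx₀ hu h0 h1.le hx) hC0
  obtain ⟨r, -, hr, hrlim⟩ := exists_seq_strictMono_tendsto' (zero_lt_one (α := ℝ))
  have hr0 : ∀ n, 0 ≤ r n := fun n => (hr n).1.le
  have hr1 : ∀ n, r n < 1 := fun n => (hr n).2
  have hlim : ∀ x ∈ interior P.body, Filter.Tendsto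
      (fun n => ENNReal.ofReal (P.bump x * (hess (dilate x₀ (r n) u) x).trace)) Filter.atTop
      (nhds (ENNReal.ofReal (P.bump x * (hess u x).trace))) := by
    intro x hx
    refine ENNReal.tendsto_ofReal (Filter.Tendsto.const_mul _ ?_)
    have e : ∀ n, (hess (dilate x₀ (r n) u) x).trace
        = r n ^ 2 * (hess u (x₀ + r n • (x - x₀))).trace := fun n => by
      have hc : ContDiffAt ℝ 2 u (x₀ + r n • (x - x₀)) :=
        (hu.1.2.2.contDiffAt (isOpen_interior.mem_nhds (P.dilation_mem_interior hx₀
          (interior_subset hx) (hr0 n) (hr1 n)))).of_le two_le_infty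
      rw [← smul_eq_mul, ← Matrix.trace_smul, ← hess_comp_dilation x₀ (r n) hc]
      rfl
    simp only [e]
    have hcont : ContinuousAt (fun y => (hess u y).trace) x :=
      (continuousOn_trace_hess isOpen_interior hu.1.2.2).continuousAt
        (isOpen_interior.mem_nhds hx)
    have hpt : Filter.Tendsto (fun n => x₀ + r n • (x - x₀)) Filter.atTop (nhds x) := by
      simpa using (hrlim.smul_const (x - x₀)).const_add x₀
    simpa using (hrlim.pow 2).mul (hcont.tendsto.comp hpt)
  calc ∫⁻ x in interior P.body, ENNReal.ofReal (P.bump x * (hess u x).trace)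
      = ∫⁻ x in interior P.body, Filter.liminf
          (fun n => ENNReal.ofReal (P.bump x * (hess (dilate x₀ (r n) u) x).trace))
          Filter.atTop :=
        setLIntegral_congr_fun isOpen_interior.measurableSet fun x hx =>
          (hlim x hx).liminf_eq.symm
    _ ≤ Filter.liminf (fun n => ∫⁻ x in interior P.body,
          ENNReal.ofReal (P.bump x * (hess (dilate x₀ (r n) u) x).trace)) Filter.atTop := by
        refine lintegral_liminf_le' fun n => ?_
        have hc := (continuousOn_trace_hess (isOpen_dilateDomain (P := P) (x₀ := x₀) (r n))
          (contDiffOn_dilate hu (r n))).mono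
          (interior_subset.trans (body_subset_dilateDomain hx₀ (hr0 n) (hr1 n)))
        exact ((P.contDiff_bump.continuous.continuousOn.mul hc).aemeasurable
          isOpen_interior.measurableSet).ennreal_ofReal
    _ ≤ ENNReal.ofReal (C * ∫ x in P.body, u x) := by
        refine Filter.liminf_le_of_frequently_le' (Filter.Frequently.of_forall fun n => ?_)
        exact key (r n) (hr0 n) (hr1 n)

end IntegrationByParts

end LabelledPolytope

namespace LabelledPolytope

variable {m : ℕ} (P : LabelledPolytope m)

/-! ### The Futaki functional, the boundary norm and the projection -/

section Functionals

lemma ae_boundaryMeasure_mem_body : ∀ᵐ x ∂P.boundaryMeasure, x ∈ P.body := by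
  rw [boundaryMeasure, ae_finsetSum_measure_iff]
  intro j _
  filter_upwards [ae_restrict_mem (P.isCompact_facet j).measurableSet] with x hx using hx.1

lemma restrict_interior_body :
    (volume : Measure (EuclideanSpace ℝ (Fin m))).restrict (interior P.body)
      = volume.restrict P.body :=
  Measure.restrict_congr_set
    (interior_ae_eq_of_null_frontier (P.convex_body.addHaar_frontier volume))

lemma ae_mem_interior_body : ∀ᵐ x ∂volume.restrict P.body, x ∈ interior P.body := by
  rw [← P.restrict_interior_body]
  exact ae_restrict_mem isOpen_interior.measurableSet

variable {P} {f : EuclideanSpace ℝ (Fin m) →ᵃ[ℝ] ℝ} {hf : ∀ x ∈ P.body, 0 < f x}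
  {u v : EuclideanSpace ℝ (Fin m) → ℝ}

lemma continuous_affine (g : EuclideanSpace ℝ (Fin m) →ᵃ[ℝ] ℝ) : Continuous g :=
  g.continuous_of_finiteDimensional

lemma continuousOn_div_pow (hf : ∀ x ∈ P.body, 0 < f x) (hu : ContinuousOn u P.body) (n : ℕ) :
    ContinuousOn (fun x => u x / f x ^ n) P.body :=
  hu.div ((continuous_affine f).pow n).continuousOn fun x hx => (pow_pos (hf x hx) n).ne'

lemma bNorm_add_mul (hf : ∀ x ∈ P.body, 0 < f x) (hu : ContinuousOn u P.body)
    (hv : ContinuousOn v P.body) (c : ℝ) :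
    P.bNorm f (fun x => u x + c * v x) = P.bNorm f u + c * P.bNorm f v := by
  have h1 := P.integrable_boundary (continuousOn_div_pow hf hu (2 * m - 1))
  have h2 := P.integrable_boundary (continuousOn_div_pow hf hv (2 * m - 1))
  rw [bNorm, bNorm, bNorm, ← integral_const_mul, ← integral_add h1 (h2.const_mul c)]
  congr 1; ext x; ring

lemma futaki_add_mul (hu : ContinuousOn u P.body) (hv : ContinuousOn v P.body) (c : ℝ) :
    P.futaki f hf (fun x => u x + c * v x) = P.futaki f hf u + c * P.futaki f hf v := by
  have hi : ∀ w, ContinuousOn w P.body → IntegrableOn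
      (fun x => P.extremalAffine f hf x * w x / f x ^ (2 * m + 1)) P.body := fun w hw =>
    (continuousOn_div_pow hf ((continuous_affine _).continuousOn.mul hw) _).integrableOn_compact
      P.isCompact_body
  have h1 := bNorm_add_mul hf hu hv c
  simp only [bNorm] at h1
  have h2 : ∫ x in P.body, P.extremalAffine f hf x * (u x + c * v x) / f x ^ (2 * m + 1)
      = (∫ x in P.body, P.extremalAffine f hf x * u x / f x ^ (2 * m + 1))
        + c * ∫ x in P.body, P.extremalAffine f hf x * v x / f x ^ (2 * m + 1) := by
    rw [← integral_const_mul, ← integral_add (hi u hu) ((hi v hv).const_mul c)]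
    congr 1; ext x; ring
  rw [futaki, futaki, futaki, h1, h2]
  ring

lemma futaki_affine (φ : EuclideanSpace ℝ (Fin m) →ᵃ[ℝ] ℝ) : P.futaki f hf φ = 0 :=
  (P.existsUnique_extremalAffine f hf).choose_spec.1 φ

lemma bNorm_nonneg (hf : ∀ x ∈ P.body, 0 < f x) (hu : ∀ x ∈ P.body, 0 ≤ u x) :
    0 ≤ P.bNorm f u := by
  refine integral_nonneg_of_ae ?_
  filter_upwards [P.ae_boundaryMeasure_mem_body] with x hx
  exact div_nonneg (hu x hx) (pow_pos (hf x hx) _).le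

/-- The affine function tangent to `u` at `x₀`. -/
noncomputable def tangent (u : EuclideanSpace ℝ (Fin m) → ℝ) (x₀ : EuclideanSpace ℝ (Fin m)) :
    EuclideanSpace ℝ (Fin m) →ᵃ[ℝ] ℝ :=
  (fderiv ℝ u x₀).toLinearMap.toAffineMap + AffineMap.const ℝ _ (u x₀ - fderiv ℝ u x₀ x₀)

lemma proj_eq (u : EuclideanSpace ℝ (Fin m) → ℝ) (x₀ : EuclideanSpace ℝ (Fin m)) :
    proj x₀ u = fun x => u x + (-1) * tangent u x₀ x := by
  ext x
  simp [proj, tangent]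
  ring

lemma futaki_proj (hu : ContinuousOn u P.body) (x₀ : EuclideanSpace ℝ (Fin m)) :
    P.futaki f hf (proj x₀ u) = P.futaki f hf u := by
  rw [proj_eq, futaki_add_mul hu (continuous_affine _).continuousOn, futaki_affine, mul_zero,
    add_zero]

/-- Convexity is known in the interior only. Shrinking all points towards an interior point and
letting the ratio tend to one carries the inequality to the boundary by continuity. -/
lemma convexOn_body_of_mem_potentials (hu : u ∈ P.potentials) : ConvexOn ℝ P.body u := by
  refine ⟨P.convex_body, fun x hx y hy a b ha hb hab => ?_⟩
  obtain ⟨z, hz⟩ := P.interior_body_nonempty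
  obtain ⟨r, -, hr, hrlim⟩ := exists_seq_strictMono_tendsto' (zero_lt_one (α := ℝ))
  have hr0 : ∀ n, 0 ≤ r n := fun n => (hr n).1.le
  have hr1 : ∀ n, r n < 1 := fun n => (hr n).2
  have hlim := fun w (hw : w ∈ P.body) => tendsto_dilate hz hu.1 hr0 hr1 hrlim hw
  refine le_of_tendsto_of_tendsto (hlim _ (P.convex_body hx hy ha hb hab))
    (((hlim x hx).const_mul a).add ((hlim y hy).const_mul b)) (.of_forall fun n => ?_)
  have h := hu.2.2.1.convexOn.2 (P.dilation_mem_interior hz hx (hr0 n) (hr1 n))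
    (P.dilation_mem_interior hz hy (hr0 n) (hr1 n)) ha hb hab
  have e : a • (z + r n • (x - z)) + b • (z + r n • (y - z))
      = z + r n • (a • x + b • y - z) := by
    obtain rfl : b = 1 - a := by linarith
    module
  rw [e] at h
  exact h

lemma proj_mem_CTilde {x₀ : EuclideanSpace ℝ (Fin m)} (hx₀ : x₀ ∈ interior P.body)
    (hu : u ∈ P.potentials) : proj x₀ u ∈ P.CTilde x₀ := by
  have hcv := convexOn_body_of_mem_potentials hu
  have hd : DifferentiableAt ℝ u x₀ :=
    (hu.2.1.contDiffAt (isOpen_interior.mem_nhds hx₀)).differentiableAt (by simp)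
  have ht : ContDiff ℝ ∞ fun x => u x₀ + fderiv ℝ u x₀ (x - x₀) :=
    contDiff_const.add ((fderiv ℝ u x₀).contDiff.comp (contDiff_id.sub contDiff_const))
  refine ⟨⟨hu.1.sub ht.continuous.continuousOn, ?_, hu.2.1.sub ht.contDiffOn⟩, ?_, ?_⟩
  · refine ⟨P.convex_body, fun x hx y hy a b ha hb hab => ?_⟩
    have h := hcv.2 hx hy ha hb hab
    simp only [proj, smul_eq_mul, map_sub, map_add, map_smul] at h ⊢
    obtain rfl : b = 1 - a := by linarith
    linarith
  · simp [proj]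
  · intro x hx
    have := hcv.add_fderiv_le (interior_subset hx₀) hx hd
    simp only [proj]
    linarith

/-- On normalized convex functions the boundary norm controls the `L¹` norm. -/
lemma exists_integral_body_le_bNorm (hm : 1 ≤ m) (hf : ∀ x ∈ P.body, 0 < f x)
    {x₀ : EuclideanSpace ℝ (Fin m)} (hx₀ : x₀ ∈ interior P.body) :
    ∃ K : ℝ, 0 ≤ K ∧ ∀ u ∈ P.CTilde x₀, ∫ x in P.body, u x ≤ K * P.bNorm f u := by
  obtain ⟨C, hC⟩ := P.exists_lintegral_body_le hm hx₀
  obtain ⟨M, hM⟩ := P.isCompact_body.bddAbove_image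
    ((continuous_affine f).pow (2 * m - 1)).continuousOn
  have hM' : ∀ x ∈ P.body, f x ^ (2 * m - 1) ≤ M := fun x hx => hM ⟨x, hx, rfl⟩
  have hM0 : 0 ≤ M :=
    (pow_pos (hf x₀ (interior_subset hx₀)) _).le.trans (hM' x₀ (interior_subset hx₀))
  refine ⟨C * M, mul_nonneg C.coe_nonneg hM0, fun u hu => ?_⟩
  classical
  -- Nothing is known of `u` off $\triangle$; its extension by zero is Borel measurable.
  set g : EuclideanSpace ℝ (Fin m) → ℝ := P.body.piecewise u fun _ => 0 with hg
  have hgm : Measurable g := hu.1.1.measurable_piecewise continuousOn_const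
    P.isClosed_body.measurableSet
  have hgu : ∀ x ∈ P.body, g x = u x := fun x hx => Set.piecewise_eq_of_mem _ _ _ hx
  have h := hC (fun x => ENNReal.ofReal (g x)) hgm.ennreal_ofReal fun y hy r h0 h1 => by
    rw [hgu y hy, hgu _ (P.dilation_mem_body (interior_subset hx₀) hy h0 h1)]
    exact ENNReal.ofReal_le_ofReal (dilate_le hx₀ hu h0 h1 hy)
  have e1 : ∫⁻ x in P.body, ENNReal.ofReal (g x) = ENNReal.ofReal (∫ x in P.body, u x) := by
    rw [ofReal_integral_eq_lintegral_ofReal (hu.1.1.integrableOn_compact P.isCompact_body)]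
    · exact setLIntegral_congr_fun P.isClosed_body.measurableSet fun x hx => by rw [hgu x hx]
    · filter_upwards [ae_restrict_mem P.isClosed_body.measurableSet] with x hx using hu.2.2 x hx
  have e2 : ∫⁻ x, ENNReal.ofReal (g x) ∂P.boundaryMeasure
      = ENNReal.ofReal (∫ x, u x ∂P.boundaryMeasure) := by
    rw [ofReal_integral_eq_lintegral_ofReal (P.integrable_boundary hu.1.1)]
    · refine lintegral_congr_ae ?_
      filter_upwards [P.ae_boundaryMeasure_mem_body] with x hx
      rw [hgu x hx]
    · filter_upwards [P.ae_boundaryMeasure_mem_body] with x hx using hu.2.2 x hx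
  have h0 : 0 ≤ ∫ x, u x ∂P.boundaryMeasure := by
    refine integral_nonneg_of_ae ?_
    filter_upwards [P.ae_boundaryMeasure_mem_body] with x hx using hu.2.2 x hx
  rw [e1, e2, ← ENNReal.ofReal_coe_nnreal, ← ENNReal.ofReal_mul C.coe_nonneg,
    ENNReal.ofReal_le_ofReal_iff (mul_nonneg C.coe_nonneg h0)] at h
  refine h.trans ?_
  rw [mul_assoc]
  refine mul_le_mul_of_nonneg_left ?_ C.coe_nonneg
  rw [bNorm, ← integral_const_mul]
  refine integral_mono_ae (P.integrable_boundary hu.1.1)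
    ((P.integrable_boundary (continuousOn_div_pow hf hu.1.1 _)).const_mul M) ?_
  filter_upwards [P.ae_boundaryMeasure_mem_body] with x hx
  have hp := pow_pos (hf x hx) (2 * m - 1)
  rw [mul_div_assoc', le_div_iff₀ hp, mul_comm]
  exact mul_le_mul_of_nonneg_right (hM' x hx) (hu.2.2 x hx)

end Functionals

/-! ### Upper bound for the entropy -/

section EntropyBound

variable {P} {f : EuclideanSpace ℝ (Fin m) →ᵃ[ℝ] ℝ} {x₀ : EuclideanSpace ℝ (Fin m)}
  {u : EuclideanSpace ℝ (Fin m) → ℝ}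

/-- Here $-\log\det$ of the matrix is $\log\det$ of its inverse, which is at most the trace of the
inverse; that trace extends continuously to the compact $\triangle$ by `saddleInv` with $R=0$. -/
lemma exists_neg_log_det_canonicalHess_le :
    ∃ C : ℝ, 0 ≤ C ∧ ∀ x ∈ interior P.body, -Real.log (P.canonicalHess x).det ≤ C := by
  have hc : ContinuousOn (fun x => (P.saddleInv 0 x).trace) P.body := by
    simp only [Matrix.trace, Matrix.diag]
    exact continuousOn_finsetSum _ fun i _ =>
      (P.contDiffOn_saddle_inv (R := fun _ => 0) (fun _ _ => Matrix.PosSemidef.zero)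
        (fun _ _ => contDiffOn_const) (Sum.inl i) (Sum.inl i)).continuousOn
  obtain ⟨C, hC⟩ := P.isCompact_body.bddAbove_image hc
  refine ⟨max C 0, le_max_right _ _, fun x hx => ?_⟩
  have hpd := P.posDef_canonicalHess hx
  have h := log_det_le_trace hpd.inv.posSemidef one_pos
  rw [Matrix.det_nonsing_inv, Ring.inverse_eq_inv', Real.log_inv] at h
  have e : P.saddleInv 0 x = (P.canonicalHess x)⁻¹ := by
    rw [P.saddleInv_eq_inv Matrix.PosSemidef.zero hx, add_zero]
  have h2 : (P.saddleInv 0 x).trace ≤ C := hC ⟨x, interior_subset hx, rfl⟩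
  rw [e] at h2
  simp only [one_mul, Real.log_one, abs_zero, mul_zero, add_zero] at h
  exact (h.trans h2).trans (le_max_left _ _)

lemma integrableOn_bump_mul_trace_hess (hx₀ : x₀ ∈ interior P.body) (hu : u ∈ P.CTilde x₀) :
    IntegrableOn (fun x => P.bump x * (hess u x).trace) P.body := by
  obtain ⟨C, -, hC⟩ := P.exists_lintegral_bump_mul_trace_hess_le hx₀
  rw [IntegrableOn, ← P.restrict_interior_body]
  refine ⟨(P.contDiff_bump.continuous.continuousOn.mul
    (continuousOn_trace_hess isOpen_interior hu.1.2.2)).aestronglyMeasurable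
      isOpen_interior.measurableSet, ?_⟩
  rw [hasFiniteIntegral_iff_ofReal]
  · exact (hC u hu).trans_lt ENNReal.ofReal_lt_top
  · filter_upwards [ae_restrict_mem isOpen_interior.measurableSet] with x hx
    exact mul_nonneg (P.bump_nonneg x) (posSemidef_hess isOpen_interior
      (hu.1.2.1.subset interior_subset P.convex_body.interior) hu.1.2.2 hx).trace_nonneg

lemma exists_integral_bump_mul_trace_hess_le (hx₀ : x₀ ∈ interior P.body) :
    ∃ C : ℝ, 0 ≤ C ∧ ∀ u ∈ P.CTilde x₀,
      ∫ x in P.body, P.bump x * (hess u x).trace ≤ C * ∫ x in P.body, u x := by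
  obtain ⟨C, hC0, hC⟩ := P.exists_lintegral_bump_mul_trace_hess_le hx₀
  refine ⟨C, hC0, fun u hu => ?_⟩
  have h := hC u hu
  have hi := integrableOn_bump_mul_trace_hess hx₀ hu
  rw [IntegrableOn, ← P.restrict_interior_body] at hi
  rw [← ofReal_integral_eq_lintegral_ofReal hi, ENNReal.ofReal_le_ofReal_iff,
    P.restrict_interior_body] at h
  · exact h
  · refine mul_nonneg hC0 (setIntegral_nonneg P.isClosed_body.measurableSet fun x hx => hu.2.2 x hx)
  · filter_upwards [ae_restrict_mem isOpen_interior.measurableSet] with x hx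
    exact mul_nonneg (P.bump_nonneg x) (posSemidef_hess isOpen_interior
      (hu.1.2.1.subset interior_subset P.convex_body.interior) hu.1.2.2 hx).trace_nonneg

/-- This avoids proving that the entropy density is integrable: otherwise its Bochner integral is
zero, below the integral of the nonnegative majorant. -/
lemma integral_le_of_le_of_nonneg {α : Type*} [MeasurableSpace α] {μ : Measure α} {g h : α → ℝ}
    (hh : Integrable h μ) (h0 : 0 ≤ᵐ[μ] h) (hgh : g ≤ᵐ[μ] h) : ∫ x, g x ∂μ ≤ ∫ x, h x ∂μ := by
  by_cases hg : Integrable g μ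
  · exact integral_mono_ae hg hh hgh
  · rw [integral_undef hg]
    exact integral_nonneg_of_ae h0

/-- The entropy term of the K-energy is dominated by an arbitrarily small multiple of the boundary
norm. -/
lemma exists_entropy_le (hm : 1 ≤ m) (hf : ∀ x ∈ P.body, 0 < f x) (hx₀ : x₀ ∈ interior P.body)
    {ε : ℝ} (hε : 0 < ε) :
    ∃ C : ℝ, ∀ u ∈ P.potentials,
      ∫ x in P.body, (Real.log (hess u x).det - Real.log (hess P.canonicalPotential x).det)
        / f x ^ (2 * m - 1) ≤ ε * P.bNorm f (proj x₀ u) + C := by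
  obtain ⟨K, hK0, hK⟩ := exists_integral_body_le_bNorm hm hf hx₀
  obtain ⟨A, hA0, hA⟩ := exists_integral_bump_mul_trace_hess_le hx₀
  obtain ⟨C₀, hC₀, hC₀'⟩ := exists_neg_log_det_canonicalHess_le (P := P)
  obtain ⟨W, hW⟩ := P.isCompact_body.bddAbove_image
    (continuousOn_div_pow hf (u := fun _ => 1) continuousOn_const (2 * m - 1))
  have hW' : ∀ x ∈ P.body, 1 / f x ^ (2 * m - 1) ≤ W := fun x hx => hW ⟨x, hx, rfl⟩
  have hW0 : 0 ≤ W := (div_pos one_pos (pow_pos (hf x₀ (interior_subset hx₀)) _)).le.trans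
    (hW' x₀ (interior_subset hx₀))
  -- `W` bounds the weight, `A` comes from integrating by parts and `K` from the cone estimate. The
  -- summand `1` keeps the denominator positive when their product vanishes.
  set t : ℝ := ε / (W * A * K + 1) with ht
  have hden : 0 < W * A * K + 1 := by positivity
  have ht0 : 0 < t := div_pos hε hden
  have htK : t * (W * A * K) ≤ ε := by
    rw [ht, div_mul_eq_mul_div, div_le_iff₀ hden]
    nlinarith
  set b : EuclideanSpace ℝ (Fin m) → ℝ := fun x =>
    m * (|Real.log t| + ∑ j, 3 * |Real.log (P.L j x)|) + C₀ with hb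
  have hb0 : ∀ x, 0 ≤ b x := fun x => by positivity
  have hbi : IntegrableOn b P.body := by
    have hconst : ∀ c : ℝ, IntegrableOn (fun _ => c) P.body := fun c =>
      continuousOn_const.integrableOn_compact P.isCompact_body
    exact (((hconst _).add (integrable_finsetSum _ fun j _ =>
      (P.integrableOn_abs_log_L j).const_mul 3)).const_mul _).add (hconst _)
  refine ⟨W * ∫ x in P.body, b x, fun u hu => ?_⟩
  set v := proj x₀ u with hv
  have hvC : v ∈ P.CTilde x₀ := proj_mem_CTilde hx₀ hu
  have hpsd : ∀ x ∈ interior P.body, (hess v x).PosSemidef := fun x hx =>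
    posSemidef_hess isOpen_interior
      (hvC.1.2.1.subset interior_subset P.convex_body.interior) hvC.1.2.2 hx
  have hti := integrableOn_bump_mul_trace_hess hx₀ hvC
  have hhi : IntegrableOn (fun x => W * (t * (P.bump x * (hess v x).trace) + b x)) P.body :=
    ((hti.const_mul t).add hbi).const_mul W
  have hpt : ∀ x ∈ interior P.body, 0 ≤ t * (P.bump x * (hess v x).trace) + b x := fun x hx =>
    add_nonneg (mul_nonneg ht0.le (mul_nonneg (P.bump_nonneg x) (hpsd x hx).trace_nonneg)) (hb0 x)
  have hle := integral_le_of_le_of_nonneg (μ := volume.restrict P.body)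
    (g := fun x => (Real.log (hess u x).det - Real.log (hess P.canonicalPotential x).det)
        / f x ^ (2 * m - 1)) hhi
    (by filter_upwards [P.ae_mem_interior_body] with x hx using mul_nonneg hW0 (hpt x hx))
    (by
      filter_upwards [P.ae_mem_interior_body] with x hx
      have hψ := P.bump_pos hx
      have hu2 : ContDiffAt ℝ 2 u x :=
        (hu.2.1.contDiffAt (isOpen_interior.mem_nhds hx)).of_le two_le_infty
      -- The pointwise constant is $c=t\psi(x)$; the resulting $|\log c|$ is absorbed in the
      -- integrable `b`.
      have h1 := log_det_le_trace (hpsd x hx) (mul_pos ht0 hψ)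
      rw [Fintype.card_fin, mul_assoc, Real.log_mul ht0.ne' hψ.ne'] at h1
      have h2 : |Real.log t + Real.log (P.bump x)|
          ≤ |Real.log t| + ∑ j, 3 * |Real.log (P.L j x)| :=
        (abs_add_le _ _).trans (add_le_add le_rfl (P.abs_log_bump_le hx))
      have h3 := mul_le_mul_of_nonneg_left h2 (Nat.cast_nonneg (α := ℝ) m)
      have h4 := hC₀' x hx
      rw [hv, hess_proj hu2] at h1
      have h5 : Real.log (hess u x).det - Real.log (hess P.canonicalPotential x).det
          ≤ t * (P.bump x * (hess v x).trace) + b x := by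
        rw [P.hess_canonicalPotential hx, hv, hess_proj hu2]
        simp only [hb]
        linarith
      have hw := hW' x (interior_subset hx)
      have hw0 : 0 ≤ 1 / f x ^ (2 * m - 1) :=
        (div_pos one_pos (pow_pos (hf x (interior_subset hx)) _)).le
      rw [div_eq_mul_one_div, mul_comm]
      exact (mul_le_mul_of_nonneg_left h5 hw0).trans
        (mul_le_mul_of_nonneg_right hw (hpt x hx)))
  refine hle.trans ?_
  rw [integral_const_mul, integral_add (hti.const_mul t) hbi, integral_const_mul, mul_add]
  refine add_le_add ?_ le_rfl
  have h1 : ∫ x in P.body, P.bump x * (hess v x).trace ≤ A * (K * P.bNorm f v) :=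
    (hA v hvC).trans (mul_le_mul_of_nonneg_left (hK v hvC) hA0)
  have hn : 0 ≤ P.bNorm f v := bNorm_nonneg hf hvC.2.2
  calc W * (t * ∫ x in P.body, P.bump x * (hess v x).trace)
      ≤ W * (t * (A * (K * P.bNorm f v))) := by gcongr
    _ = t * (W * A * K) * P.bNorm f v := by ring
    _ ≤ ε * P.bNorm f v := mul_le_mul_of_nonneg_right htK hn

end EntropyBound

/-! ### The two implications -/

section Stability

variable {P} {f : EuclideanSpace ℝ (Fin m) →ᵃ[ℝ] ℝ} {hf : ∀ x ∈ P.body, 0 < f x}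
  {x₀ : EuclideanSpace ℝ (Fin m)} {u : EuclideanSpace ℝ (Fin m) → ℝ}

lemma kEnergy_proper_of_futaki_le (hm : 1 ≤ m) (hx₀ : x₀ ∈ interior P.body) {lam δ : ℝ}
    (h : ∀ u ∈ P.CTilde x₀, lam * P.bNorm f u ≤ P.futaki f hf u) (hδ : δ < lam) :
    ∃ C : ℝ, ∀ u ∈ P.potentials,
      δ * P.bNorm f (proj x₀ u) + C ≤ P.kEnergy f hf u := by
  obtain ⟨C, hC⟩ := exists_entropy_le hm hf hx₀ (sub_pos.2 hδ)
  refine ⟨-C, fun u hu => ?_⟩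
  have h1 := h _ (proj_mem_CTilde hx₀ hu)
  rw [futaki_proj hu.1] at h1
  have h2 := hC u hu
  rw [kEnergy]
  linarith

/-- Adding a convex function to $u_0$ can only increase the determinant of the Hessian, so the
entropy is nonnegative and may be dropped. -/
lemma kEnergy_canonicalPotential_add_le {s : Set (EuclideanSpace ℝ (Fin m))} (hs : IsOpen s)
    (hbs : P.body ⊆ s) {w : EuclideanSpace ℝ (Fin m) → ℝ} (hw : ConvexOn ℝ s w)
    (hd : ContDiffOn ℝ ∞ w s) {c : ℝ} (hc : 0 ≤ c) :
    P.kEnergy f hf (fun x => P.canonicalPotential x + c * w x)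
      ≤ P.futaki f hf P.canonicalPotential + c * P.futaki f hf w := by
  rw [kEnergy, futaki_add_mul P.continuous_canonicalPotential.continuousOn
    (hd.continuousOn.mono hbs), sub_le_self_iff]
  refine integral_nonneg_of_ae ?_
  filter_upwards [P.ae_mem_interior_body] with x hx
  have hxs := hbs (interior_subset hx)
  refine div_nonneg (sub_nonneg.2 ?_) (pow_pos (hf x (interior_subset hx)) _).le
  have hw2 : ContDiffAt ℝ 2 w x := (hd.contDiffAt (hs.mem_nhds hxs)).of_le two_le_infty
  have hc2 : ContDiffAt ℝ 2 P.canonicalPotential x :=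
    (P.contDiffOn_canonicalPotential.contDiffAt (isOpen_interior.mem_nhds hx)).of_le two_le_infty
  rw [hess_add_smul hc2 hw2, P.hess_canonicalPotential hx]
  exact Real.log_le_log (P.posDef_canonicalHess hx).det_pos
    (det_le_det_add (P.posDef_canonicalHess hx) ((posSemidef_hess hs hw hd hxs).smul hc))

/-- The perturbation has a minimum with value zero at the interior point $x_0$, so its tangent there
is zero and the projection does not change it. -/
lemma proj_canonicalPotential_add (hx₀ : x₀ ∈ interior P.body)
    {w : EuclideanSpace ℝ (Fin m) → ℝ} (hd : DifferentiableAt ℝ w x₀) (hw0 : w x₀ = 0)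
    (hmin : ∀ x ∈ P.body, 0 ≤ w x) (c : ℝ) :
    proj x₀ (fun x => P.canonicalPotential x + c * w x)
      = fun x => proj x₀ P.canonicalPotential x + c * w x := by
  have hdc : DifferentiableAt ℝ P.canonicalPotential x₀ :=
    (P.contDiffOn_canonicalPotential.contDiffAt (isOpen_interior.mem_nhds hx₀)).differentiableAt
      (by simp)
  have hlm : IsLocalMin w x₀ := by
    filter_upwards [isOpen_interior.mem_nhds hx₀] with x hx
    rw [hw0]; exact hmin x (interior_subset hx)
  have h0 : fderiv ℝ w x₀ = 0 := hlm.fderiv_eq_zero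
  have h1 : fderiv ℝ (fun x => P.canonicalPotential x + c * w x) x₀
      = fderiv ℝ P.canonicalPotential x₀ := by
    have := (hdc.hasFDerivAt.add (hd.hasFDerivAt.const_mul c)).fderiv
    rw [h0, smul_zero, add_zero] at this
    exact this
  ext x
  simp only [proj, h1, hw0]
  ring

lemma le_of_forall_mul_add_le {a b A B : ℝ} (h : ∀ k : ℝ, 0 ≤ k → a + k * A ≤ b + k * B) :
    A ≤ B := by
  by_contra hlt
  have hpos : 0 < A - B := sub_pos.2 (not_le.1 hlt)
  have h1 := h ((|b - a| + 1) / (A - B)) (by positivity)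
  have h2 : (|b - a| + 1) / (A - B) * (A - B) = |b - a| + 1 := div_mul_cancel₀ _ hpos.ne'
  have h3 := le_abs_self (b - a)
  linarith

/-- Properness is tested on the ray $u_0+ku_r$, $k\ge0$. Both sides are then bounded by affine
functions of $k$, and letting $k$ grow compares the slopes; the constant `C` disappears. -/
lemma bNorm_dilate_le_futaki_dilate (hx₀ : x₀ ∈ interior P.body) {δ C : ℝ}
    (h : ∀ u ∈ P.potentials, δ * P.bNorm f (proj x₀ u) + C ≤ P.kEnergy f hf u)
    (hu : u ∈ P.CTilde x₀) {r : ℝ} (h0 : 0 ≤ r) (h1 : r < 1) :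
    δ * P.bNorm f (dilate x₀ r u) ≤ P.futaki f hf (dilate x₀ r u) := by
  have hs := isOpen_dilateDomain (P := P) (x₀ := x₀) r
  have hbs := body_subset_dilateDomain hx₀ h0 h1
  have hd := contDiffOn_dilate hu r
  have hcv := convexOn_dilate hu r
  have hdx : DifferentiableAt ℝ (dilate x₀ r u) x₀ :=
    (hd.contDiffAt (hs.mem_nhds (hbs (interior_subset hx₀)))).differentiableAt (by simp)
  have hw0 : dilate x₀ r u x₀ = 0 := by simpa [dilate] using hu.2.1
  have hpc : ContinuousOn (proj x₀ P.canonicalPotential) P.body := by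
    rw [proj_eq]
    exact (P.continuous_canonicalPotential.add
      (continuous_const.mul (continuous_affine _))).continuousOn
  refine le_of_forall_mul_add_le (a := δ * P.bNorm f (proj x₀ P.canonicalPotential) + C)
    (b := P.futaki f hf P.canonicalPotential) fun k hk => ?_
  have h2 := (h _ (P.canonicalPotential_add_mem_potentials hs hbs hcv hd hk)).trans
    (kEnergy_canonicalPotential_add_le hs hbs hcv hd hk)
  rw [proj_canonicalPotential_add hx₀ hdx hw0 (fun x hx => dilate_nonneg hx₀ hu h0 h1.le hx),
    bNorm_add_mul hf hpc (hd.continuousOn.mono hbs)] at h2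
  linarith

lemma continuousOn_dilate (hx₀ : x₀ ∈ interior P.body) (hu : u ∈ P.CTilde x₀) {r : ℝ}
    (h0 : 0 ≤ r) (h1 : r < 1) : ContinuousOn (dilate x₀ r u) P.body :=
  (contDiffOn_dilate hu r).continuousOn.mono (body_subset_dilateDomain hx₀ h0 h1)

lemma abs_dilate_le (hx₀ : x₀ ∈ interior P.body) (hu : u ∈ P.CTilde x₀) {r : ℝ} (h0 : 0 ≤ r)
    (h1 : r ≤ 1) {x : EuclideanSpace ℝ (Fin m)} (hx : x ∈ P.body) :
    |dilate x₀ r u x| ≤ |u x| :=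
  abs_le_abs_of_nonneg (dilate_nonneg hx₀ hu h0 h1 hx) (dilate_le hx₀ hu h0 h1 hx)

lemma tendsto_bNorm_dilate (hf : ∀ x ∈ P.body, 0 < f x) (hx₀ : x₀ ∈ interior P.body)
    (hu : u ∈ P.CTilde x₀) {r : ℕ → ℝ}
    (hr0 : ∀ n, 0 ≤ r n) (hr1 : ∀ n, r n < 1) (hr : Filter.Tendsto r Filter.atTop (nhds 1)) :
    Filter.Tendsto (fun n => P.bNorm f (dilate x₀ (r n) u)) Filter.atTop
      (nhds (P.bNorm f u)) := by
  refine tendsto_integral_of_dominated_convergence (fun x => |u x / f x ^ (2 * m - 1)|)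
    (fun n => (P.integrable_boundary (continuousOn_div_pow hf
      (continuousOn_dilate hx₀ hu (hr0 n) (hr1 n)) _)).aestronglyMeasurable)
    (P.integrable_boundary (continuousOn_div_pow hf hu.1.1 _)).abs (fun n => ?_) ?_
  · filter_upwards [P.ae_boundaryMeasure_mem_body] with x hx
    rw [Real.norm_eq_abs, abs_div, abs_div]
    exact div_le_div_of_nonneg_right (abs_dilate_le hx₀ hu (hr0 n) (hr1 n).le hx) (abs_nonneg _)
  · filter_upwards [P.ae_boundaryMeasure_mem_body] with x hx
    exact (tendsto_dilate hx₀ hu.1.1 hr0 hr1 hr hx).div_const _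

lemma tendsto_futaki_dilate (hx₀ : x₀ ∈ interior P.body) (hu : u ∈ P.CTilde x₀) {r : ℕ → ℝ}
    (hr0 : ∀ n, 0 ≤ r n) (hr1 : ∀ n, r n < 1) (hr : Filter.Tendsto r Filter.atTop (nhds 1)) :
    Filter.Tendsto (fun n => P.futaki f hf (dilate x₀ (r n) u)) Filter.atTop
      (nhds (P.futaki f hf u)) := by
  refine ((tendsto_bNorm_dilate hf hx₀ hu hr0 hr1 hr).const_mul 2).sub ?_
  have hi : ∀ w, ContinuousOn w P.body → IntegrableOn
      (fun x => P.extremalAffine f hf x * w x / f x ^ (2 * m + 1)) P.body := fun w hw =>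
    (continuousOn_div_pow hf ((continuous_affine _).continuousOn.mul hw) _).integrableOn_compact
      P.isCompact_body
  refine tendsto_integral_of_dominated_convergence
    (fun x => |P.extremalAffine f hf x * u x / f x ^ (2 * m + 1)|)
    (fun n => (hi _ (continuousOn_dilate hx₀ hu (hr0 n) (hr1 n))).aestronglyMeasurable)
    (hi u hu.1.1).abs (fun n => ?_) ?_
  · filter_upwards [ae_restrict_mem P.isClosed_body.measurableSet] with x hx
    rw [Real.norm_eq_abs, abs_div, abs_div, abs_mul, abs_mul]
    exact div_le_div_of_nonneg_right (mul_le_mul_of_nonneg_left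
      (abs_dilate_le hx₀ hu (hr0 n) (hr1 n).le hx) (abs_nonneg _)) (abs_nonneg _)
  · filter_upwards [ae_restrict_mem P.isClosed_body.measurableSet] with x hx
    exact ((tendsto_dilate hx₀ hu.1.1 hr0 hr1 hr hx).const_mul _).div_const _

lemma futaki_le_of_kEnergy_proper (hx₀ : x₀ ∈ interior P.body) {δ C : ℝ}
    (h : ∀ u ∈ P.potentials, δ * P.bNorm f (proj x₀ u) + C ≤ P.kEnergy f hf u)
    (hu : u ∈ P.CTilde x₀) : δ * P.bNorm f u ≤ P.futaki f hf u := by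
  obtain ⟨r, -, hr, hlim⟩ := exists_seq_strictMono_tendsto' (zero_lt_one (α := ℝ))
  have hr0 : ∀ n, 0 ≤ r n := fun n => (hr n).1.le
  have hr1 : ∀ n, r n < 1 := fun n => (hr n).2
  exact le_of_tendsto_of_tendsto' ((tendsto_bNorm_dilate hf hx₀ hu hr0 hr1 hlim).const_mul δ)
    (tendsto_futaki_dilate hx₀ hu hr0 hr1 hlim) fun n =>
      bNorm_dilate_le_futaki_dilate hx₀ h hu (hr0 n) (hr1 n)

end Stability

end LabelledPolytope

end ToricStability

theorem mainTheorem2 {m : ℕ} (hm : 1 ≤ m) (P : ToricStability.LabelledPolytope m)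
    (f : EuclideanSpace ℝ (Fin m) →ᵃ[ℝ] ℝ) (hf : ∀ x ∈ P.body, 0 < f x)
    (x₀ : EuclideanSpace ℝ (Fin m)) (hx₀ : x₀ ∈ interior P.body)
    (lam : ℝ) (hlam : 0 < lam) :
    (∀ u ∈ P.CTilde x₀, lam * P.bNorm f u ≤ P.futaki f hf u) ↔
      ∀ δ : ℝ, 0 ≤ δ → δ < lam → ∃ C : ℝ, ∀ u ∈ P.potentials,
        δ * P.bNorm f (ToricStability.proj x₀ u) + C ≤ P.kEnergy f hf u := by
  refine ⟨fun h δ _ hδ =>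
    ToricStability.LabelledPolytope.kEnergy_proper_of_futaki_le hm hx₀ h hδ, fun h u hu => ?_⟩
  have hδ : ∀ δ ∈ Set.Ico 0 lam, δ * P.bNorm f u ≤ P.futaki f hf u := fun δ hδ => by
    obtain ⟨C, hC⟩ := h δ hδ.1 hδ.2
    exact ToricStability.LabelledPolytope.futaki_le_of_kEnergy_proper hx₀ hC hu
  -- The inequality is closed in `δ`, so it passes to the endpoint; `0 < lam` makes the interval
  -- nonempty.
  have hcl : lam ∈ closure (Set.Ico 0 lam) := by
    rw [closure_Ico hlam.ne]; exact Set.right_mem_Icc.2 hlam.le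
  exact closure_minimal (s := Set.Ico 0 lam) (t := {δ | δ * P.bNorm f u ≤ P.futaki f hf u}) hδ
    (isClosed_le (by fun_prop) continuous_const) hcl
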